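/- Let $n$ qubits be divided between two parties holding $k_1$ and $k_2=n-k_1$ qubits, with $k_1\le k_2$. A circuit is a finite sequence of gates on these $n$ qubits, without ancilla qubits, where each gate is either a local gate (an arbitrary unitary acting on qubits of a single party) or a straddling gate (an arbitrary element of $\mathrm{SU}(4)$ acting on one qubit of each party). Only straddling gates are counted; local gates are free. Then the worst-case number of straddling gates needed to implement an $n$-qubit unitary exactly is $\Theta(4^{k_1})$. That is, there are absolute constants $C, C'>0$ such that: 1. for all $k_1\le k_2$ and every way of dividing the qubits, every unitary $U\in \mathrm{U}(2^n)$ is implemented exactly by a circuit with at most $C\,4^{k_1}$ straddling gates; 2. for all $1\le k_1\le k_2$ and every way of dividing the qubits, there is a unitary $U\in\mathrm{U}(2^n)$ such that every circuit that implements $U$ exactly contains at least $C'\,4^{k_1}$ straddling gates. -/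

import Mathlib

/-- The matrix, on the qubits of `Q`, of the operator `M` acting on the qubits of `S` and trivially
on all others, i.e. `M ⊗ 1`.  Computational basis states of a set `Q` of qubits are the bit
strings `Q → Fin 2`. -/
def onQubits {Q : Type*} [Fintype Q] [DecidableEq Q] (S : Finset Q)
    (M : Matrix (S → Fin 2) (S → Fin 2) ℂ) : Matrix (Q → Fin 2) (Q → Fin 2) ℂ :=
  Matrix.of fun x y =>
    if ∀ q, q ∉ S → x q = y q then M (fun q => x q) (fun q => y q) else 0

/-- A gate on the qubits of `Q`, which are divided between the party `A` and its complement: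
either a local gate (any unitary on qubits that all belong to the same party), or a straddling
two-qubit gate (any element of `SU(4)` acting on one qubit of each party). -/
inductive BipartiteGate {Q : Type*} [DecidableEq Q] (A : Finset Q) where
  | loc (S : Finset Q) (hS : S ⊆ A ∨ Disjoint S A)
      (U : Matrix.unitaryGroup (S → Fin 2) ℂ) : BipartiteGate A
  | straddling (i j : Q) (hi : i ∈ A) (hj : j ∉ A)
      (g : Matrix.specialUnitaryGroup (({i, j} : Finset Q) → Fin 2) ℂ) : BipartiteGate A

namespace BipartiteGate

variable {Q : Type*} [DecidableEq Q] {A : Finset Q}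

/-- The operator of a gate on the whole system. -/
def toMatrix [Fintype Q] : BipartiteGate A → Matrix (Q → Fin 2) (Q → Fin 2) ℂ
  | loc S _ U => onQubits S (U : Matrix (S → Fin 2) (S → Fin 2) ℂ)
  | straddling i j _ _ g =>
      onQubits {i, j} (g : Matrix (({i, j} : Finset Q) → Fin 2) (({i, j} : Finset Q) → Fin 2) ℂ)

/-- Local gates are free, a straddling gate costs one. -/
def cost : BipartiteGate A → ℕ
  | loc _ _ _ => 0
  | straddling _ _ _ _ _ => 1

end BipartiteGate

/-- A circuit without ancilla qubits: a finite list of gates, the head being applied first. -/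
abbrev BipartiteCircuit {Q : Type*} [DecidableEq Q] (A : Finset Q) := List (BipartiteGate A)

namespace BipartiteCircuit

variable {Q : Type*} [DecidableEq Q] {A : Finset Q}

/-- The operator implemented by a circuit. -/
def toMatrix [Fintype Q] : BipartiteCircuit A → Matrix (Q → Fin 2) (Q → Fin 2) ℂ
  | [] => 1
  | g :: c => toMatrix c * g.toMatrix

/-- The number of straddling gates in a circuit. -/
def straddlingCount : BipartiteCircuit A → ℕ
  | [] => 0
  | g :: c => straddlingCount c + g.cost

end BipartiteCircuit

/-!
Let `A` be the smaller party, with `k₁` qubits, and `B` the larger one.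

*Upper bound.* Fix a qubit `q` of `A`. By the cosine-sine decomposition and by demultiplexing
(`exists_multiplexed_decomposition`), every unitary on the qubits of `B` and on `t + 1` qubits of
`A`, including `q`, is a product of four unitaries that do not act on `q`, of one-qubit gates on
`q`, and of three multiplexed rotations `exp (i Z_q ⊗ θ)` with `θ` diagonal on the other `t` qubits
of `A` and on `B`. Expanding `θ` in characters of the `t` bits in `A`, and merging signs by CNOT
gates inside `A`, reduces such a rotation to `2 ^ t` rotations `exp (i Z_q ⊗ φ)` with `φ` diagonal
on `B` (`implementable_multiplexed_phaseGate`). Each of these costs four straddling gates, whatever the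
size of `B`: if `φ` changes sign under the flip of a bit `j`, then conjugating the local gate
`exp (i φ)` by a CNOT from `q` to `j` produces `exp (i Z_q ⊗ φ)`, and every `φ` is a constant
plus an odd function plus a permuted odd function (`exists_odd_add_odd`). The cost thus satisfies
`c (t + 1) ≤ 4 c t + 12 * 2 ^ t` with `c 0 = 0`, whence `c t ≤ 6 (4 ^ t - 2 ^ t)`
(`implementable_onQubits_union_compl`).

*Lower bound.* A circuit with `s` straddling gates is an alternating product of `s + 1` operators
`a ⊗ b` and `s` two-qubit operators, hence a value of one of countably many polynomial maps in
`(s + 1) (4 ^ k₁ + 4 ^ k₂) + 16 s` complex parameters: unitarity of the factors can be dropped, at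
the cost of a constant factor. Every matrix is a combination of four unitaries, so if all unitaries
were obtained with `s` gates, then four times as many parameters (and four more) would cover the
whole matrix space of dimension `4 ^ (k₁ + k₂)`, and smooth maps do not raise the Hausdorff
dimension (`HasSmoothCover.finrank_le_of_unitary`). For small `k₁` only `s ≥ 1` is claimed, and a controlled
phase is not of the form `a ⊗ b`.
-/

/-! ### Decompositions of unitary matrices -/

section

open Matrix

/-- The polar decomposition of a matrix with orthogonal columns of norms `|c i|`: normalizing the
nonzero columns and completing them to an orthonormal basis gives the unitary factor. -/
theorem exists_unitary_mul_diagonal {m : Type*} [Fintype m] [DecidableEq m]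
    {M : Matrix m m ℂ} {c : m → ℝ}
    (h : Mᴴ * M = diagonal fun i => ((c i : ℂ)) ^ 2) :
    ∃ V ∈ unitaryGroup m ℂ, M = V * diagonal fun i => (c i : ℂ) := by
  classical
  have hM : ∀ i j, ∑ k, star (M k i) * M k j = if i = j then (c i : ℂ) ^ 2 else 0 := by
    intro i j
    have := congrFun (congrFun h i) j
    simpa [mul_apply, diagonal_apply] using this
  let v : m → EuclideanSpace ℂ m := fun i => WithLp.toLp 2 fun k => (c i : ℂ)⁻¹ * M k i
  have hinner : ∀ i j, inner ℂ (v i) (v j) =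
      ((c i : ℂ)⁻¹ * (c j : ℂ)⁻¹) * if i = j then (c i : ℂ) ^ 2 else 0 := by
    intro i j
    rw [← hM, Finset.mul_sum, PiLp.inner_apply]
    refine Finset.sum_congr rfl fun k _ => ?_
    simp only [v, RCLike.inner_apply, map_mul, map_inv₀, Complex.conj_ofReal, Complex.star_def]
    ring
  have hv : Orthonormal ℂ (Set.domRestrict {i | c i ≠ 0} v) := by
    rw [orthonormal_iff_ite]
    rintro ⟨i, hi⟩ ⟨j, hj⟩
    have hi' : (c i : ℂ) ≠ 0 := by exact_mod_cast hi
    rw [Set.domRestrict_apply, Set.domRestrict_apply, hinner]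
    simp only [Subtype.mk.injEq]
    split_ifs with hij
    · subst hij
      field_simp
    · simp
  obtain ⟨b, hb⟩ := hv.exists_orthonormalBasis_extension_of_card_eq (by simp)
  have hzero : ∀ i, c i = 0 → ∀ k, M k i = 0 := by
    intro i hi k
    have h1 := hM i i
    simp only [hi, if_true, Complex.ofReal_zero] at h1
    have h2 : ∑ k, ‖M k i‖ ^ 2 = 0 := by
      have : ((∑ k, ‖M k i‖ ^ 2 : ℝ) : ℂ) = 0 := by
        push_cast
        rw [← zero_pow two_ne_zero, ← h1]
        refine Finset.sum_congr rfl fun k _ => ?_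
        rw [← Complex.conj_mul']; rfl
      exact_mod_cast this
    have h3 := (Finset.sum_eq_zero_iff_of_nonneg (fun k _ => by positivity)).1 h2 k
      (Finset.mem_univ k)
    simpa using h3
  refine ⟨of fun k i => b i k, ?_, ?_⟩
  · rw [mem_unitaryGroup_iff']
    ext i j
    have := orthonormal_iff_ite.1 b.orthonormal i j
    rw [PiLp.inner_apply] at this
    rw [one_apply, ← this, mul_apply]
    refine Finset.sum_congr rfl fun k _ => ?_
    simp [RCLike.inner_apply, star_apply, mul_comm]
  · ext k i
    rw [mul_diagonal, of_apply]
    by_cases hi : c i = 0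
    · rw [hzero i hi, hi]; simp
    · have hi' : (c i : ℂ) ≠ 0 := by exact_mod_cast hi
      rw [hb i hi]
      simp only [v]
      field_simp

/-- The spectral theorem for unitary matrices, from the one for Hermitian matrices by a Cayley
transform centred at a point that is not an eigenvalue. -/
theorem exists_unitary_diagonalization {m : Type*} [Fintype m] [DecidableEq m]
    {Q : Matrix m m ℂ} (hQ : Q ∈ unitaryGroup m ℂ) :
    ∃ V ∈ unitaryGroup m ℂ, ∃ θ : m → ℝ,
      Q = V * diagonal (fun i => Complex.exp (θ i * Complex.I)) * Vᴴ := by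
  classical
  -- a point of the unit circle that is not an eigenvalue of `Q`
  obtain ⟨w, hw, hdet⟩ : ∃ w : ℂ, ‖w‖ = 1 ∧ (w • (1 : Matrix m m ℂ) - Q).det ≠ 0 := by
    have hinf : (Metric.sphere (0 : ℂ) 1).Infinite := by
      refine (isPreconnected_sphere (by simp [Complex.rank_real_complex]) 0
        1).infinite_of_nontrivial
        ⟨1, by simp, -1, by simp, ?_⟩
      norm_num
    obtain ⟨w, hw, hw'⟩ := hinf.exists_notMem_finset Q.charpoly.roots.toFinset
    refine ⟨w, by simpa using hw, fun h0 => hw' ?_⟩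
    rw [Multiset.mem_toFinset, Polynomial.mem_roots (charpoly_monic Q).ne_zero,
      Polynomial.IsRoot, eval_charpoly]
    rwa [smul_one_eq_diagonal] at h0
  have hQ1 : Q * Qᴴ = 1 := mem_unitaryGroup_iff.1 hQ
  have hQ2 : Qᴴ * Q = 1 := mem_unitaryGroup_iff'.1 hQ
  have hww : star w * w = 1 := by
    rw [Complex.star_def, Complex.conj_mul', hw]; simp
  set R : Matrix m m ℂ := w • 1 - Q with hR
  have hu : IsUnit R.det := isUnit_iff_ne_zero.2 hdet
  have hR1 : R * R⁻¹ = 1 := mul_nonsing_inv _ hu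
  have hR2 : R⁻¹ * R = 1 := nonsing_inv_mul _ hu
  -- the Cayley transform of `Q` is Hermitian
  set H : Matrix m m ℂ := Complex.I • (R⁻¹ * (w • 1 + Q)) with hH
  have hRH : R * H = Complex.I • (w • 1 + Q) := by
    rw [hH, mul_smul_comm, ← mul_assoc, hR1, one_mul]
  have hRstar : Rᴴ * Q = -(star w • R) := by
    rw [hR]
    simp only [conjTranspose_sub, conjTranspose_smul, conjTranspose_one, sub_mul, hQ2,
      smul_mul_assoc,
      one_mul, smul_sub, smul_smul, hww, one_smul]
    abel
  have hHerm : H.IsHermitian := by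
    have hcomm : (w • 1 + Q) * R = R * (w • 1 + Q) := by
      rw [hR]
      simp only [add_mul, mul_sub, sub_mul, mul_add, smul_mul_assoc, one_mul,
        mul_smul_comm, mul_one, smul_add, smul_sub]
      abel
    have hHR : H * R = Complex.I • (w • 1 + Q) := by
      rw [hH, smul_mul_assoc, mul_assoc, hcomm, ← mul_assoc, hR2, one_mul]
    have h1 : Hᴴ * Rᴴ = -(Complex.I • (star w • 1 + Qᴴ)) := by
      rw [← conjTranspose_mul, hRH]
      simp
      abel
    have h2 : Hᴴ * R = H * R := by
      have : Hᴴ * (Rᴴ * Q) = -(Complex.I • (star w • 1 + Qᴴ)) * Q := by rw [← mul_assoc, h1]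
      rw [hRstar, neg_mul, mul_neg, neg_inj, smul_mul_assoc, add_mul, hQ2,
        smul_mul_assoc, one_mul, mul_smul_comm] at this
      have h3 : Hᴴ * R = w • (star w • (Hᴴ * R)) := by
        rw [smul_smul, mul_comm, hww, one_smul]
      rw [h3, this, hHR, smul_comm, smul_add, smul_smul, mul_comm w, hww, one_smul, add_comm]
    calc Hᴴ = Hᴴ * R * R⁻¹ := by rw [mul_assoc, hR1, mul_one]
      _ = H := by rw [h2, mul_assoc, hR1, mul_one]
  obtain ⟨V, hV, d, hd⟩ : ∃ V ∈ unitaryGroup m ℂ, ∃ d : m → ℝ,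
      H = V * diagonal (fun i => (d i : ℂ)) * Vᴴ := by
    refine ⟨hHerm.eigenvectorUnitary, hHerm.eigenvectorUnitary.2, hHerm.eigenvalues, ?_⟩
    have := hHerm.spectral_theorem
    rw [Unitary.conjStarAlgAut_apply] at this
    exact this
  have hV1 : V * Vᴴ = 1 := mem_unitaryGroup_iff.1 hV
  have hV2 : Vᴴ * V = 1 := mem_unitaryGroup_iff'.1 hV
  set P : Matrix m m ℂ := Vᴴ * Q * V with hP
  have hQP : Q = V * P * Vᴴ := by
    calc Q = (V * Vᴴ) * Q * (V * Vᴴ) := by rw [hV1, one_mul, mul_one]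
      _ = V * P * Vᴴ := by simp only [hP, mul_assoc]
  have hPd : (w • 1 - P) * diagonal (fun i => (d i : ℂ)) = Complex.I • (w • 1 + P) := by
    have : Vᴴ * (R * H) * V = Vᴴ * (Complex.I • (w • 1 + Q)) * V := by rw [hRH]
    rw [hd, hR] at this
    simp only [mul_add, add_mul, mul_smul_comm, smul_mul_assoc, mul_one, hV2] at this
    rw [hP, ← this]
    calc _ = (w • (Vᴴ * V) - Vᴴ * Q * V) * diagonal (fun i => (d i : ℂ)) * (Vᴴ * V) := by
            rw [hV2, mul_one]
      _ = _ := by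
        simp only [mul_sub, sub_mul, mul_smul_comm, smul_mul_assoc, mul_assoc, one_mul]
  have hPoff : ∀ i j, i ≠ j → P i j = 0 := by
    intro i j hij
    have := congrFun (congrFun hPd i) j
    simp only [mul_diagonal, Matrix.sub_apply, Matrix.add_apply, Matrix.smul_apply,
      one_apply_ne hij,
      smul_eq_mul] at this
    have h1 : (Complex.I + d j) * P i j = 0 := by linear_combination -this
    rcases mul_eq_zero.1 h1 with h | h
    · have := congrArg Complex.im h
      simp at this
    · exact h
  have hPdiag : P = diagonal fun i => P i i := by
    ext i j
    by_cases hij : i = j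
    · subst hij; simp
    · rw [hPoff i j hij, diagonal_apply_ne _ hij]
  have hPu : Pᴴ * P = 1 := by
    simp only [hP, conjTranspose_mul, conjTranspose_conjTranspose]
    calc _ = Vᴴ * (Qᴴ * (V * Vᴴ) * Q) * V := by simp only [mul_assoc]
      _ = 1 := by rw [hV1, mul_one, hQ2, mul_one, hV2]
  have hnorm : ∀ i, ‖P i i‖ = 1 := by
    intro i
    rw [hPdiag, diagonal_conjTranspose, diagonal_mul_diagonal] at hPu
    have := congrFun (congrFun hPu i) i
    simp only [diagonal_apply_eq, Pi.star_apply, one_apply_eq, Complex.star_def,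
      Complex.conj_mul'] at this
    have h2 : ‖P i i‖ ^ 2 = 1 := by exact_mod_cast this
    exact (pow_eq_one_iff_of_nonneg (norm_nonneg _) two_ne_zero).1 h2
  refine ⟨V, hV, fun i => (P i i).arg, ?_⟩
  rw [hQP]
  congr 2
  rw [hPdiag]
  congr 1
  ext i
  have := Complex.norm_mul_exp_arg_mul_I (P i i)
  rw [hnorm i, Complex.ofReal_one, one_mul] at this
  simpa using this.symm

/-- Demultiplexing `L₁ ⊕ L₂ = (V ⊕ V) (D ⊕ D⁻¹) (W ⊕ W)`: diagonalize `L₁ L₂⁻¹ = V D² V⁻¹`. -/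
theorem exists_demultiplexing {m : Type*} [Fintype m] [DecidableEq m]
    {L₁ L₂ : Matrix m m ℂ} (h₁ : L₁ ∈ unitaryGroup m ℂ) (h₂ : L₂ ∈ unitaryGroup m ℂ) :
    ∃ V ∈ unitaryGroup m ℂ, ∃ W ∈ unitaryGroup m ℂ, ∃ θ : m → ℝ,
      L₁ = V * diagonal (fun i => Complex.exp (θ i * Complex.I)) * W ∧
      L₂ = V * diagonal (fun i => Complex.exp (-(θ i) * Complex.I)) * W := by
  obtain ⟨V, hV, φ, hφ⟩ := exists_unitary_diagonalization
    (mul_mem h₁ (Unitary.star_mem h₂))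
  have hV1 : V * Vᴴ = 1 := mem_unitaryGroup_iff.1 hV
  have hL2 : star L₂ * L₂ = 1 := mem_unitaryGroup_iff'.1 h₂
  have hmul : ∀ a b : m → ℂ, (∀ i, a i * b i = 1) →
      diagonal a * diagonal b = (1 : Matrix m m ℂ) := by
    intro a b hab
    rw [diagonal_mul_diagonal]
    simp [hab]
  have hE : diagonal (fun i => Complex.exp (((φ i / 2 : ℝ) : ℂ) * Complex.I)) ∈
      unitaryGroup m ℂ := by
    rw [mem_unitaryGroup_iff, star_eq_conjTranspose, diagonal_conjTranspose]
    apply hmul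
    intro i
    rw [Pi.star_apply, Complex.star_def, ← Complex.exp_conj, ← Complex.exp_add, map_mul,
        Complex.conj_ofReal, Complex.conj_I, mul_neg, add_neg_cancel, Complex.exp_zero]
  refine ⟨V, hV, diagonal (fun i => Complex.exp (((φ i / 2 : ℝ) : ℂ) * Complex.I)) *
    star V * L₂, mul_mem (mul_mem hE (Unitary.star_mem hV)) h₂, fun i => φ i / 2, ?_, ?_⟩
  · have h : diagonal (fun i => Complex.exp (φ i * Complex.I)) =
        diagonal (fun i => Complex.exp (((φ i / 2 : ℝ) : ℂ) * Complex.I)) *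
        diagonal (fun i => Complex.exp (((φ i / 2 : ℝ) : ℂ) * Complex.I)) := by
      rw [diagonal_mul_diagonal]
      congr 1
      ext i
      rw [← Complex.exp_add]
      congr 1
      push_cast
      ring
    calc L₁ = L₁ * star L₂ * L₂ := by rw [mul_assoc, hL2, mul_one]
      _ = _ := by
        rw [hφ, h, star_eq_conjTranspose]
        simp only [mul_assoc]
  · have h : diagonal (fun i => Complex.exp (-((φ i / 2 : ℝ) : ℂ) * Complex.I)) *
        diagonal (fun i => Complex.exp (((φ i / 2 : ℝ) : ℂ) * Complex.I)) = 1 := by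
      apply hmul
      intro i
      rw [← Complex.exp_add]
      simp
    calc L₂ = V * 1 * Vᴴ * L₂ := by rw [mul_one, hV1, one_mul]
      _ = _ := by
        rw [← h, star_eq_conjTranspose]
        simp only [mul_assoc]

/-- The cosine-sine decomposition of a unitary matrix in `2 × 2` block form. -/
theorem exists_cosineSine {m : Type*} [Fintype m] [DecidableEq m]
    {U : Matrix (m ⊕ m) (m ⊕ m) ℂ} (hU : U ∈ unitaryGroup (m ⊕ m) ℂ) :
    ∃ V₁ ∈ unitaryGroup m ℂ, ∃ V₂ ∈ unitaryGroup m ℂ, ∃ W₁ ∈ unitaryGroup m ℂ,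
      ∃ W₂ ∈ unitaryGroup m ℂ, ∃ θ : m → ℝ,
      U = fromBlocks V₁ 0 0 V₂ *
        fromBlocks (diagonal fun i => (Real.cos (θ i) : ℂ))
          (-diagonal fun i => (Real.sin (θ i) : ℂ))
          (diagonal fun i => (Real.sin (θ i) : ℂ)) (diagonal fun i => (Real.cos (θ i) : ℂ)) *
        fromBlocks W₁ 0 0 W₂ := by
  classical
  set X := U.toBlocks₁₁ with hX
  set Z := U.toBlocks₂₁ with hZ
  have hUb : U = fromBlocks X U.toBlocks₁₂ Z U.toBlocks₂₂ := (fromBlocks_toBlocks U).symm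
  have hXZ : Xᴴ * X + Zᴴ * Z = 1 := by
    have h := mem_unitaryGroup_iff'.1 hU
    rw [star_eq_conjTranspose, hUb, fromBlocks_conjTranspose, fromBlocks_multiply,
      ← fromBlocks_one, fromBlocks_inj] at h
    exact h.1
  have hHerm : (Xᴴ * X).IsHermitian := isHermitian_conjTranspose_mul_self X
  obtain ⟨W, hW, d, hd⟩ : ∃ W ∈ unitaryGroup m ℂ, ∃ d : m → ℝ,
      Xᴴ * X = W * diagonal (fun i => (d i : ℂ)) * Wᴴ := by
    refine ⟨hHerm.eigenvectorUnitary, hHerm.eigenvectorUnitary.2, hHerm.eigenvalues, ?_⟩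
    have := hHerm.spectral_theorem
    rw [Unitary.conjStarAlgAut_apply] at this
    exact this
  have hW1 : W * Wᴴ = 1 := mem_unitaryGroup_iff.1 hW
  have hW2 : Wᴴ * W = 1 := mem_unitaryGroup_iff'.1 hW
  have hXW : (X * W)ᴴ * (X * W) = diagonal fun i => (d i : ℂ) := by
    calc _ = Wᴴ * (Xᴴ * X) * W := by simp only [conjTranspose_mul, mul_assoc]
      _ = (Wᴴ * W) * diagonal (fun i => (d i : ℂ)) * (Wᴴ * W) := by rw [hd]; simp only [mul_assoc]
      _ = _ := by rw [hW2, one_mul, mul_one]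
  have hZW : (Z * W)ᴴ * (Z * W) = diagonal fun i => ((1 - d i : ℝ) : ℂ) := by
    calc _ = Wᴴ * (Xᴴ * X + Zᴴ * Z) * W - (X * W)ᴴ * (X * W) := by
          simp only [conjTranspose_mul, mul_assoc, mul_add, add_mul]; abel
      _ = 1 - diagonal (fun i => (d i : ℂ)) := by rw [hXZ, hXW, mul_one, hW2]
      _ = _ := by
        rw [← diagonal_one, diagonal_sub]; congr 1; ext i; push_cast; rfl
  have hnn : ∀ (Y : Matrix m m ℂ) (e : m → ℝ), Yᴴ * Y = diagonal (fun i => (e i : ℂ)) →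
      ∀ i, 0 ≤ e i := by
    intro Y e h i
    have h1 := congrFun (congrFun h i) i
    simp only [mul_apply, conjTranspose_apply, diagonal_apply_eq, Complex.star_def,
      Complex.conj_mul'] at h1
    have h2 : ∑ k, ‖Y k i‖ ^ 2 = e i := by exact_mod_cast h1
    rw [← h2]; positivity
  have hd0 : ∀ i, 0 ≤ d i := hnn _ _ hXW
  have hd1 : ∀ i, 0 ≤ 1 - d i := hnn _ _ hZW
  set θ : m → ℝ := fun i => Real.arccos (Real.sqrt (d i)) with hθ
  have hcos : ∀ i, Real.cos (θ i) = Real.sqrt (d i) := fun i =>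
    Real.cos_arccos (by linarith [Real.sqrt_nonneg (d i)])
      (Real.sqrt_le_one.2 (by linarith [hd1 i]))
  have hsin : ∀ i, Real.sin (θ i) = Real.sqrt (1 - d i) := fun i => by
    rw [hθ, Real.sin_arccos, Real.sq_sqrt (hd0 i)]
  obtain ⟨V₁, hV₁, hXV⟩ := exists_unitary_mul_diagonal (M := X * W)
    (c := fun i => Real.cos (θ i)) (by
      rw [hXW]; congr 1; ext i; rw [hcos, ← Complex.ofReal_pow, Real.sq_sqrt (hd0 i)])
  obtain ⟨V₂, hV₂, hZV⟩ := exists_unitary_mul_diagonal (M := Z * W)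
    (c := fun i => Real.sin (θ i)) (by
      rw [hZW]; congr 1; ext i; rw [hsin, ← Complex.ofReal_pow, Real.sq_sqrt (hd1 i)])
  have hX' : X = V₁ * diagonal (fun i => (Real.cos (θ i) : ℂ)) * Wᴴ := by
    rw [← hXV, mul_assoc, hW1, mul_one]
  have hZ' : Z = V₂ * diagonal (fun i => (Real.sin (θ i) : ℂ)) * Wᴴ := by
    rw [← hZV, mul_assoc, hW1, mul_one]
  set c : Matrix m m ℂ := diagonal (fun i => (Real.cos (θ i) : ℂ)) with hc
  set s : Matrix m m ℂ := diagonal (fun i => (Real.sin (θ i) : ℂ)) with hs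
  have hcc : cᴴ = c := by
    rw [hc, diagonal_conjTranspose]; congr 1; ext i; simp [-Complex.ofReal_cos]
  have hss : sᴴ = s := by
    rw [hs, diagonal_conjTranspose]; congr 1; ext i; simp [-Complex.ofReal_sin]
  have hcs : c * c + s * s = 1 := by
    rw [hc, hs, diagonal_mul_diagonal, diagonal_mul_diagonal, diagonal_add, ← diagonal_one]
    congr 1; ext i
    have := Real.cos_sq_add_sin_sq (θ i)
    rw [← Complex.ofReal_mul, ← Complex.ofReal_mul, ← Complex.ofReal_add, ← sq, ← sq, this]; simp
  have hcomm : s * c = c * s := by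
    rw [hc, hs, diagonal_mul_diagonal, diagonal_mul_diagonal]
    congr 1; ext i; ring
  have hV₁' : V₁ᴴ * V₁ = 1 := mem_unitaryGroup_iff'.1 hV₁
  have hV₂' : V₂ᴴ * V₂ = 1 := mem_unitaryGroup_iff'.1 hV₂
  have hblock : ∀ {P R : Matrix m m ℂ}, P ∈ unitaryGroup m ℂ → R ∈ unitaryGroup m ℂ →
      fromBlocks P 0 0 R ∈ unitaryGroup (m ⊕ m) ℂ := by
    intro P R hP hR
    rw [mem_unitaryGroup_iff, star_eq_conjTranspose, fromBlocks_conjTranspose, fromBlocks_multiply]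
    have h1 : P * Pᴴ = 1 := mem_unitaryGroup_iff.1 hP
    have h2 : R * Rᴴ = 1 := mem_unitaryGroup_iff.1 hR
    simp [h1, h2]
  have hCS : fromBlocks c (-s) s c ∈ unitaryGroup (m ⊕ m) ℂ := by
    rw [mem_unitaryGroup_iff, star_eq_conjTranspose, fromBlocks_conjTranspose, fromBlocks_multiply]
    have hcs' : s * s + c * c = 1 := by rw [add_comm]; exact hcs
    simp [hcc, hss, hcs, hcs', hcomm]
  -- removing the two known factors leaves a unitary whose first block column is `(Wᴴ, 0)`
  set G := fromBlocks V₁ 0 0 V₂ * fromBlocks c (-s) s c with hG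
  have hGu : G ∈ unitaryGroup (m ⊕ m) ℂ := mul_mem (hblock hV₁ hV₂) hCS
  have hGG : G * Gᴴ = 1 := mem_unitaryGroup_iff.1 hGu
  set K := Gᴴ * U with hK
  have hKu : K ∈ unitaryGroup (m ⊕ m) ℂ := mul_mem (Unitary.star_mem hGu) hU
  have hK11 : K.toBlocks₁₁ = Wᴴ ∧ K.toBlocks₂₁ = 0 := by
    have : K = fromBlocks (Wᴴ) K.toBlocks₁₂ 0 K.toBlocks₂₂ := by
      conv_lhs => rw [← fromBlocks_toBlocks K]
      have e : K = fromBlocks (c * V₁ᴴ) (s * V₂ᴴ) (-s * V₁ᴴ) (c * V₂ᴴ) *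
          fromBlocks X U.toBlocks₁₂ Z U.toBlocks₂₂ := by
        rw [hK, ← hUb, hG]
        simp [conjTranspose_mul, fromBlocks_conjTranspose, fromBlocks_multiply, hcc, hss]
      have e1 : K.toBlocks₁₁ = c * V₁ᴴ * X + s * V₂ᴴ * Z := by
        rw [e, fromBlocks_multiply, toBlocks_fromBlocks₁₁]
      have e2 : K.toBlocks₂₁ = -s * V₁ᴴ * X + c * V₂ᴴ * Z := by
        rw [e, fromBlocks_multiply, toBlocks_fromBlocks₂₁]
      have f1 : V₁ᴴ * X = c * Wᴴ := by
        rw [hX', ← mul_assoc, ← mul_assoc, hV₁', one_mul]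
      have f2 : V₂ᴴ * Z = s * Wᴴ := by
        rw [hZ', ← mul_assoc, ← mul_assoc, hV₂', one_mul]
      rw [e1, e2, mul_assoc, mul_assoc, mul_assoc, mul_assoc, f1, f2, ← mul_assoc, ← mul_assoc,
        ← mul_assoc, ← mul_assoc, ← add_mul, ← add_mul, hcs, one_mul, neg_mul, hcomm]
      simp
    constructor
    · rw [this, toBlocks_fromBlocks₁₁]
    · rw [this, toBlocks_fromBlocks₂₁]
  have hK12 : K.toBlocks₁₂ = 0 ∧ K.toBlocks₂₂ ∈ unitaryGroup m ℂ := by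
    have h := mem_unitaryGroup_iff'.1 hKu
    rw [star_eq_conjTranspose, ← fromBlocks_toBlocks K, hK11.1, hK11.2, fromBlocks_conjTranspose,
      fromBlocks_multiply, ← fromBlocks_one, fromBlocks_inj] at h
    simp only [conjTranspose_conjTranspose, conjTranspose_zero, zero_mul, add_zero, mul_zero] at h
    have h0 : K.toBlocks₁₂ = 0 := by
      calc K.toBlocks₁₂ = Wᴴ * (W * K.toBlocks₁₂) := by rw [← mul_assoc, hW2, one_mul]
        _ = 0 := by rw [h.2.1, mul_zero]
    refine ⟨h0, mem_unitaryGroup_iff'.2 ?_⟩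
    have := h.2.2.2
    rwa [h0, mul_zero, zero_add] at this
  refine ⟨V₁, hV₁, V₂, hV₂, Wᴴ, Unitary.star_mem hW, K.toBlocks₂₂, hK12.2, θ, ?_⟩
  have : fromBlocks Wᴴ 0 0 K.toBlocks₂₂ = K := by
    conv_rhs => rw [← fromBlocks_toBlocks K, hK11.1, hK11.2, hK12.1]
  rw [this, ← hG, hK, ← mul_assoc, hGG, one_mul]

/-- The multiplexed `Z`-rotation `e^{iθ} ⊕ e^{-iθ}`, where `θ` is a real diagonal matrix. -/
noncomputable def phaseBlocks {m : Type*} [DecidableEq m] (θ : m → ℝ) : Matrix (m ⊕ m) (m ⊕ m) ℂ :=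
  Matrix.fromBlocks (Matrix.diagonal fun i => Complex.exp (θ i * Complex.I)) 0 0
    (Matrix.diagonal fun i => Complex.exp (-(θ i) * Complex.I))

/-- The operator `k ⊗ 1`, for a `2 × 2` matrix `k`, in block form. -/
def qubitBlocks {m : Type*} [DecidableEq m] (k : Matrix (Fin 2) (Fin 2) ℂ) :
    Matrix (m ⊕ m) (m ⊕ m) ℂ :=
  Matrix.fromBlocks (k 0 0 • 1) (k 0 1 • 1) (k 1 0 • 1) (k 1 1 • 1)

/-- One change of basis `k` on the distinguished qubit turns every multiplexed `Z`-rotation into a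
multiplexed `Y`-rotation, i.e. into the middle factor of a cosine-sine decomposition. -/
theorem exists_zRotation_conj_eq_yRotation :
    ∃ k ∈ unitaryGroup (Fin 2) ℂ, ∀ {m : Type*} [Fintype m] [DecidableEq m] (θ : m → ℝ),
      fromBlocks (diagonal fun i => (Real.cos (θ i) : ℂ)) (-diagonal fun i => (Real.sin (θ i) : ℂ))
          (diagonal fun i => (Real.sin (θ i) : ℂ)) (diagonal fun i => (Real.cos (θ i) : ℂ)) =
        qubitBlocks k * phaseBlocks (-θ) * qubitBlocks (star k) := by
  -- the columns of `k` are the eigenvectors of the rotation, of norm one as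
  -- `|(1 + i) / 2|² = 1 / 2`
  have hI : Complex.I ^ 2 = -1 := Complex.I_sq
  obtain ⟨a, haa⟩ : ∃ a : ℂ, a * (starRingEnd ℂ) a = 1 / 2 := by
    refine ⟨(1 + Complex.I) / 2, ?_⟩
    rw [map_div₀, Complex.conj_ofNat, map_add, map_one, Complex.conj_I]
    linear_combination (-1 / 4) * hI
  refine ⟨!![a, a; a * Complex.I, -(a * Complex.I)], ?_, ?_⟩
  · rw [mem_unitaryGroup_iff]
    ext i j
    fin_cases i <;> fin_cases j <;>
      simp only [mul_apply, Fin.sum_univ_two, star_apply, of_apply, cons_val', cons_val_zero,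
        cons_val_one, map_mul, map_neg, Complex.star_def, Complex.conj_I,
        Fin.zero_eta, Fin.mk_one, one_apply, cons_val_fin_one] <;>
      norm_num
    · linear_combination 2 * haa
    · linear_combination (-2 * Complex.I ^ 2) * haa - hI
  · intro m _ _ θ
    have hc : ∀ i, (Real.cos (θ i) : ℂ) =
        (Complex.exp (θ i * Complex.I) + Complex.exp (-(θ i) * Complex.I)) / 2 := fun i => by
      rw [Complex.ofReal_cos, Complex.cos]
    have hs : ∀ i, (Real.sin (θ i) : ℂ) =
        (Complex.exp (-(θ i) * Complex.I) - Complex.exp (θ i * Complex.I)) * Complex.I / 2 :=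
      fun i => by rw [Complex.ofReal_sin, Complex.sin]
    have hk : ∀ i j, star (!![a, a; a * Complex.I, -(a * Complex.I)]) i j =
        star ((!![a, a; a * Complex.I, -(a * Complex.I)] : Matrix (Fin 2) (Fin 2) ℂ) j i) :=
      fun i j => rfl
    unfold qubitBlocks phaseBlocks
    rw [fromBlocks_multiply, fromBlocks_multiply, fromBlocks_inj]
    simp only [hk, of_apply, cons_val', cons_val_zero, cons_val_one, cons_val_fin_one, map_mul,
      map_neg, Complex.star_def, Complex.conj_I, smul_mul_assoc, one_mul, mul_smul_comm, mul_one,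
      mul_zero, zero_add, add_zero, Pi.neg_apply, Complex.ofReal_neg, neg_neg, hc, hs]
    refine ⟨?_, ?_, ?_, ?_⟩ <;> ext i j <;> rcases eq_or_ne i j with rfl | hij <;>
      simp [diagonal_apply_ne, *]
    · linear_combination -(Complex.exp (θ i * Complex.I) + Complex.exp (-(θ i * Complex.I))) * haa
    · linear_combination Complex.I *
        (Complex.exp (-(θ i * Complex.I)) - Complex.exp (θ i * Complex.I)) * haa
    · linear_combination -Complex.I *
        (Complex.exp (-(θ i * Complex.I)) - Complex.exp (θ i * Complex.I)) * haa
    · linear_combination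
        (Complex.exp (θ i * Complex.I) + Complex.exp (-(θ i * Complex.I))) * Complex.I ^ 2 * haa +
        (Complex.exp (θ i * Complex.I) + Complex.exp (-(θ i * Complex.I))) / 2 * hI

/-- Up to operators `k` on the distinguished qubit, every unitary is a product of three multiplexed
`Z`-rotations and only four unitaries that ignore this qubit, since the cosine-sine decomposition
leaves two block diagonal factors and demultiplexing each of them yields two. -/
theorem exists_multiplexed_decomposition :
    ∃ k ∈ unitaryGroup (Fin 2) ℂ, ∀ {m : Type*} [Fintype m] [DecidableEq m]
      {U : Matrix (m ⊕ m) (m ⊕ m) ℂ}, U ∈ unitaryGroup (m ⊕ m) ℂ →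
    ∃ V₁ ∈ unitaryGroup m ℂ, ∃ V₂ ∈ unitaryGroup m ℂ, ∃ V₃ ∈ unitaryGroup m ℂ,
      ∃ V₄ ∈ unitaryGroup m ℂ, ∃ θ₁ θ₂ θ₃ : m → ℝ,
      U = fromBlocks V₁ 0 0 V₁ * phaseBlocks θ₁ * fromBlocks V₂ 0 0 V₂ *
        (qubitBlocks k * phaseBlocks θ₂ * qubitBlocks (star k)) *
        (fromBlocks V₃ 0 0 V₃ * phaseBlocks θ₃ * fromBlocks V₄ 0 0 V₄) := by
  obtain ⟨k, hk, hrot⟩ := exists_zRotation_conj_eq_yRotation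
  refine ⟨k, hk, fun {m} _ _ U hU => ?_⟩
  obtain ⟨L₁, hL₁, L₂, hL₂, R₁, hR₁, R₂, hR₂, θ, rfl⟩ := exists_cosineSine hU
  obtain ⟨V₁, hV₁, V₂, hV₂, θ₁, rfl, rfl⟩ := exists_demultiplexing hL₁ hL₂
  obtain ⟨V₃, hV₃, V₄, hV₄, θ₃, rfl, rfl⟩ := exists_demultiplexing hR₁ hR₂
  refine ⟨V₁, hV₁, V₂, hV₂, V₃, hV₃, V₄, hV₄, θ₁, -θ, θ₃, ?_⟩
  rw [hrot]
  simp [phaseBlocks, fromBlocks_multiply, -fromBlocks_diagonal]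

end

/-! ### Operators acting on some of the qubits -/

open Matrix Kronecker in
theorem onQubits_eq_kronecker {Q : Type*} [Fintype Q] [DecidableEq Q] (S : Finset Q)
    (M : Matrix (S → Fin 2) (S → Fin 2) ℂ) :
    onQubits S M = (M ⊗ₖ (1 : Matrix ({q // q ∉ S} → Fin 2) ({q // q ∉ S} → Fin 2) ℂ)).submatrix
      (Equiv.piEquivPiSubtypeProd (fun q => q ∈ S) fun _ => Fin 2)
      (Equiv.piEquivPiSubtypeProd (fun q => q ∈ S) fun _ => Fin 2) := by
  ext x y
  simp only [onQubits, of_apply, submatrix_apply, kroneckerMap_apply, one_apply,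
    Equiv.piEquivPiSubtypeProd_apply, funext_iff, Subtype.forall, mul_ite, mul_one, mul_zero]

section

variable {Q : Type*} [Fintype Q] [DecidableEq Q] (S : Finset Q)

open Matrix

theorem onQubits_mul (M N : Matrix (S → Fin 2) (S → Fin 2) ℂ) :
    onQubits S (M * N) = onQubits S M * onQubits S N := by
  rw [onQubits_eq_kronecker, onQubits_eq_kronecker, onQubits_eq_kronecker, submatrix_mul_equiv,
    ← mul_kronecker_mul, one_mul]

theorem onQubits_conjTranspose (M : Matrix (S → Fin 2) (S → Fin 2) ℂ) :
    onQubits S Mᴴ = (onQubits S M)ᴴ := by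
  rw [onQubits_eq_kronecker, onQubits_eq_kronecker, conjTranspose_submatrix,
    conjTranspose_kronecker, conjTranspose_one]

@[simp]
theorem onQubits_one : onQubits S 1 = 1 := by
  rw [onQubits_eq_kronecker, one_kronecker_one, submatrix_one_equiv]

theorem onQubits_add (M N : Matrix (S → Fin 2) (S → Fin 2) ℂ) :
    onQubits S (M + N) = onQubits S M + onQubits S N := by
  ext x y
  simp only [onQubits, of_apply, Matrix.add_apply]
  split_ifs <;> simp

theorem onQubits_smul (a : ℂ) (M : Matrix (S → Fin 2) (S → Fin 2) ℂ) :
    onQubits S (a • M) = a • onQubits S M := by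
  ext x y
  simp only [onQubits, of_apply, Matrix.smul_apply]
  split_ifs <;> simp

theorem onQubits_injective : Function.Injective (onQubits S) := by
  intro M N h
  ext x y
  have := congrFun (congrFun h fun q => if hq : q ∈ S then x ⟨q, hq⟩ else 0)
    fun q => if hq : q ∈ S then y ⟨q, hq⟩ else 0
  simpa +contextual [onQubits] using this

variable {S}

theorem onQubits_mem_unitaryGroup_iff {M : Matrix (S → Fin 2) (S → Fin 2) ℂ} :
    onQubits S M ∈ unitaryGroup (Q → Fin 2) ℂ ↔ M ∈ unitaryGroup (S → Fin 2) ℂ := by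
  rw [mem_unitaryGroup_iff, mem_unitaryGroup_iff, star_eq_conjTranspose, star_eq_conjTranspose,
    ← onQubits_conjTranspose, ← onQubits_mul, ← onQubits_one S, (onQubits_injective S).eq_iff]

/-- `M` acts only on the qubits of `S` as soon as its entries vanish unless the bits outside `S`
agree, and do not depend on the common value of these bits. -/
theorem mem_range_onQubits {M : Matrix (Q → Fin 2) (Q → Fin 2) ℂ}
    (h₀ : ∀ x y q, q ∉ S → x q ≠ y q → M x y = 0)
    (h₁ : ∀ x y x' y', (∀ q ∉ S, x q = y q) → (∀ q ∉ S, x' q = y' q) →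
      (∀ q ∈ S, x q = x' q) → (∀ q ∈ S, y q = y' q) → M x y = M x' y') :
    M ∈ Set.range (onQubits S) := by
  refine ⟨of fun x y => M (fun q => if hq : q ∈ S then x ⟨q, hq⟩ else 0)
    fun q => if hq : q ∈ S then y ⟨q, hq⟩ else 0, ?_⟩
  ext x y
  simp only [onQubits, of_apply]
  split_ifs with h
  · refine h₁ _ _ _ _ ?_ h ?_ ?_ <;> intro q hq <;> simp [hq]
  · push Not at h
    obtain ⟨q, hq, hxy⟩ := h
    exact (h₀ x y q hq hxy).symm

theorem range_onQubits_mono {T : Finset Q} (h : S ⊆ T) :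
    Set.range (onQubits S) ⊆ Set.range (onQubits T) := by
  rintro _ ⟨M, rfl⟩
  apply mem_range_onQubits
  · intro x y q hq hxy
    simp only [onQubits, of_apply]
    rw [if_neg]
    exact fun h' => hxy (h' q fun hS => hq (h hS))
  · intro x y x' y' h1 h2 h3 h4
    have hx : (fun q : S => x q) = fun q : S => x' q := funext fun q => h3 q (h q.2)
    have hy : (fun q : S => y q) = fun q : S => y' q := funext fun q => h4 q (h q.2)
    have hc : (∀ q ∉ S, x q = y q) ↔ ∀ q ∉ S, x' q = y' q := by
      refine forall₂_congr fun q _ => ?_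
      by_cases hq : q ∈ T
      · rw [h3 q hq, h4 q hq]
      · simp [h1 q hq, h2 q hq]
    simp only [onQubits, of_apply, hx, hy, hc]

theorem diagonal_mem_range_onQubits {d : (Q → Fin 2) → ℂ} (hd : DependsOn d (S : Set Q)) :
    diagonal d ∈ Set.range (onQubits S) := by
  apply mem_range_onQubits
  · intro x y q _ hxy
    exact diagonal_apply_ne _ fun h => hxy (congrFun h q)
  · intro x y x' y' h1 h2 h3 h4
    have hc : x = y ↔ x' = y' := by
      rw [funext_iff, funext_iff]
      refine forall_congr' fun q => ?_
      by_cases hq : q ∈ S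
      · rw [h3 q hq, h4 q hq]
      · simp [h1 q hq, h2 q hq]
    rw [diagonal_apply, diagonal_apply, hd h3]
    simp only [hc]

theorem submatrix_one_mem_range_onQubits {σ : Equiv.Perm (Q → Fin 2)}
    (h₀ : ∀ x, ∀ q ∉ S, σ x q = x q) (h₁ : ∀ q ∈ S, DependsOn (fun x => σ x q) (S : Set Q)) :
    (1 : Matrix (Q → Fin 2) (Q → Fin 2) ℂ).submatrix σ id ∈ Set.range (onQubits S) := by
  apply mem_range_onQubits
  · intro x y q hq hxy
    rw [submatrix_apply, one_apply_ne]
    exact fun h => hxy (by rw [← h₀ x q hq, h]; rfl)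
  · intro x y x' y' h1 h2 h3 h4
    have hc : σ x = y ↔ σ x' = y' := by
      rw [funext_iff, funext_iff]
      refine forall_congr' fun q => ?_
      by_cases hq : q ∈ S
      · have : σ x q = σ x' q := h₁ q hq h3
        rw [this, h4 q hq]
      · simp [h1 q hq, h2 q hq, h₀ _ q hq]
    simp only [submatrix_apply, one_apply, id, hc]

theorem submatrix_one_mem_unitaryGroup {n : Type*} [Fintype n] [DecidableEq n]
    (σ : Equiv.Perm n) : (1 : Matrix n n ℂ).submatrix σ id ∈ unitaryGroup n ℂ := by
  rw [mem_unitaryGroup_iff, star_eq_conjTranspose, conjTranspose_submatrix, conjTranspose_one]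
  ext x y
  simp [mul_apply, one_apply, eq_comm]

/-- The diagonal unitary operator with phases `f`. -/
noncomputable def phaseGate {n : Type*} [DecidableEq n] (f : n → ℝ) : Matrix n n ℂ :=
  diagonal fun x => Complex.exp (f x * Complex.I)

theorem phaseGate_add {n : Type*} [Fintype n] [DecidableEq n] (f g : n → ℝ) :
    phaseGate (f + g) = phaseGate f * phaseGate g := by
  simp only [phaseGate, diagonal_mul_diagonal, ← Complex.exp_add, Pi.add_apply,
    Complex.ofReal_add, add_mul]

theorem phaseGate_mem_unitaryGroup {n : Type*} [Fintype n] [DecidableEq n] (f : n → ℝ) :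
    phaseGate f ∈ unitaryGroup n ℂ := by
  have h : star (phaseGate f) = phaseGate (-f) := by
    rw [phaseGate, star_eq_conjTranspose, diagonal_conjTranspose, phaseGate]
    congr 1
    ext x
    rw [Pi.star_apply, Complex.star_def, ← Complex.exp_conj]
    simp
  rw [mem_unitaryGroup_iff, h, ← phaseGate_add]
  simp [phaseGate]

/-- Permutation matrices are written `(1).submatrix σ id`; conjugation by them permutes phases. -/
theorem phaseGate_comp {n : Type*} [Fintype n] [DecidableEq n] (f : n → ℝ) (σ : Equiv.Perm n) :
    phaseGate (f ∘ σ) = (1 : Matrix n n ℂ).submatrix σ id * phaseGate f *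
      (1 : Matrix n n ℂ).submatrix σ.symm id := by
  ext x y
  rw [phaseGate, phaseGate, mul_apply, Finset.sum_eq_single (σ x)]
  · simp only [mul_diagonal, submatrix_apply, one_apply, diagonal_apply, id, Equiv.symm_apply_apply,
      Function.comp]
    split_ifs <;> simp
  · intro z _ hz
    rw [mul_diagonal, submatrix_apply, one_apply_ne (by simpa using hz.symm)]
    simp
  · simp

theorem phaseGate_mem_range_onQubits {f : (Q → Fin 2) → ℝ} (hf : DependsOn f (S : Set Q)) :
    phaseGate f ∈ Set.range (onQubits S) :=
  diagonal_mem_range_onQubits fun x y h => by rw [hf h]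

end

section

variable {Q : Type*} [Fintype Q] [DecidableEq Q] {S : Finset Q} {q : Q}

open Matrix

/-- Splitting off the value at `q` from the bit strings on `insert q S`. -/
def splitQubit (hq : q ∉ S) :
    (↥(insert q S) → Fin 2) ≃ (S → Fin 2) ⊕ (S → Fin 2) where
  toFun x := if x ⟨q, Finset.mem_insert_self q S⟩ = 0
    then Sum.inl fun r => x ⟨r, Finset.mem_insert_of_mem r.2⟩
    else Sum.inr fun r => x ⟨r, Finset.mem_insert_of_mem r.2⟩
  invFun s := Sum.elim
    (fun y r => if h : (r : Q) = q then 0 else y ⟨r, Finset.mem_of_mem_insert_of_ne r.2 h⟩)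
    (fun y r => if h : (r : Q) = q then 1 else y ⟨r, Finset.mem_of_mem_insert_of_ne r.2 h⟩) s
  left_inv x := by
    have h2 : ∀ b : Fin 2, b ≠ 0 → b = 1 := by decide
    dsimp only
    split_ifs with h <;> ext r <;> by_cases hr : (r : Q) = q
    · have : r = ⟨q, Finset.mem_insert_self q S⟩ := Subtype.ext hr
      subst this
      simp [h]
    · simp [hr]
    · have : r = ⟨q, Finset.mem_insert_self q S⟩ := Subtype.ext hr
      subst this
      simp [h2 _ h]
    · simp [hr]
  right_inv s := by
    have hne : ∀ r : S, (r : Q) ≠ q := fun r h => hq (h ▸ r.2)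
    rcases s with y | y <;> simp [hne]

theorem onQubits_insert_fromBlocks (hq : q ∉ S) (V : Matrix (S → Fin 2) (S → Fin 2) ℂ) :
    onQubits (insert q S) ((fromBlocks V 0 0 V).submatrix (splitQubit hq) (splitQubit hq)) =
      onQubits S V := by
  have h2 : ∀ b : Fin 2, b ≠ 0 → b = 1 := by decide
  ext x y
  simp only [onQubits, of_apply, submatrix_apply, splitQubit, Equiv.coe_fn_mk]
  by_cases hxy : x q = y q
  · have hc : (∀ r, r ∉ insert q S → x r = y r) ↔ ∀ r, r ∉ S → x r = y r := by
      refine forall_congr' fun r => ?_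
      rcases eq_or_ne r q with rfl | hr
      · simp [hxy]
      · simp [hr]
    simp only [hc, hxy]
    by_cases hy : y q = 0 <;> simp [hy]
  · have : ¬ ∀ r, r ∉ S → x r = y r := fun h => hxy (h q hq)
    rw [if_neg this]
    by_cases hx : x q = 0 <;> by_cases hy : y q = 0
    · exact absurd (hx.trans hy.symm) hxy
    · simp [hx, hy]
    · simp [hx, hy]
    · exact absurd ((h2 _ hx).trans (h2 _ hy).symm) hxy

/-- The eigenvalue of the Pauli operator `Z` on a basis state of one qubit. -/
def zSign (b : Fin 2) : ℝ := if b = 0 then 1 else -1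

@[simp]
theorem zSign_zero : zSign 0 = 1 := rfl

@[simp]
theorem zSign_one : zSign 1 = -1 := by simp [zSign]

theorem onQubits_insert_phaseBlocks (hq : q ∉ S) (θ : (S → Fin 2) → ℝ) :
    onQubits (insert q S) ((phaseBlocks θ).submatrix (splitQubit hq) (splitQubit hq)) =
      phaseGate fun x => zSign (x q) * θ fun r => x r := by
  have : (phaseBlocks θ).submatrix (splitQubit hq) (splitQubit hq) =
      diagonal fun x => Complex.exp ((zSign (x ⟨q, Finset.mem_insert_self q S⟩) *
        θ fun r => x ⟨r, Finset.mem_insert_of_mem r.2⟩ : ℝ) * Complex.I) := by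
    rw [phaseBlocks, fromBlocks_diagonal, submatrix_diagonal_equiv]
    congr 1
    ext x
    simp only [Function.comp, splitQubit, Equiv.coe_fn_mk, zSign]
    split_ifs <;> simp
  rw [this, phaseGate]
  ext x y
  simp only [onQubits, of_apply, diagonal_apply]
  by_cases hxy : x = y
  · subst hxy; simp
  · rw [if_neg hxy]
    by_cases hc : ∀ r, r ∉ insert q S → x r = y r
    · rw [if_pos hc, if_neg]
      intro h
      apply hxy
      ext r
      by_cases hr : r ∈ insert q S
      · rw [congrFun h ⟨r, hr⟩]
      · rw [hc r hr]
    · rw [if_neg hc]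

theorem onQubits_insert_qubitBlocks (hq : q ∉ S) (k : Matrix (Fin 2) (Fin 2) ℂ) :
    onQubits (insert q S) ((qubitBlocks k).submatrix (splitQubit hq) (splitQubit hq)) =
      onQubits {q} (k.submatrix (fun x => x ⟨q, Finset.mem_singleton_self q⟩)
        fun x => x ⟨q, Finset.mem_singleton_self q⟩) := by
  have h2 : ∀ b : Fin 2, b = 0 ∨ b = 1 := by decide
  ext x y
  have key : qubitBlocks k (splitQubit hq fun r => x r) (splitQubit hq fun r => y r) =
      if ∀ r ∈ S, x r = y r then k (x q) (y q) else 0 := by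
    have e : (fun r : S => x r) = (fun r : S => y r) ↔ ∀ r ∈ S, x r = y r := by
      simp [funext_iff]
    simp only [splitQubit, Equiv.coe_fn_mk, qubitBlocks]
    rcases h2 (x q) with hx | hx <;> rcases h2 (y q) with hy | hy <;> simp [hx, hy, one_apply, e]
  simp only [onQubits, of_apply, submatrix_apply, key]
  rw [← ite_and]
  refine if_congr ⟨?_, ?_⟩ rfl rfl
  · rintro ⟨h, h'⟩ r hr
    by_cases hrS : r ∈ S
    · exact h' r hrS
    · exact h r (by simpa [hrS] using hr)
  · intro h
    refine ⟨fun r hr => h r ?_, fun r hr => h r ?_⟩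
    · simp only [Finset.mem_insert, not_or] at hr
      simpa using hr.1
    · rw [Finset.mem_singleton]; rintro rfl; exact hq hr

end

/-! ### Circuits and elementary gates -/

/-- The operator `M` is implemented by a circuit with at most `m` straddling gates. -/
def Implementable {Q : Type*} [Fintype Q] [DecidableEq Q] (A : Finset Q) (m : ℕ)
    (M : Matrix (Q → Fin 2) (Q → Fin 2) ℂ) : Prop :=
  ∃ c : BipartiteCircuit A, BipartiteCircuit.toMatrix c = M ∧
    BipartiteCircuit.straddlingCount c ≤ m

section

variable {Q : Type*} [DecidableEq Q] {A : Finset Q}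

open Matrix

theorem BipartiteCircuit.straddlingCount_append (c d : BipartiteCircuit A) :
    straddlingCount (c ++ d) = straddlingCount c + straddlingCount d := by
  induction c with
  | nil => simp [straddlingCount]
  | cons g c ih =>
    change straddlingCount (c ++ d) + g.cost = straddlingCount c + g.cost + straddlingCount d
    rw [ih]; ring

/-- The action of the gate CNOT with control `r` and target `p` on the basis states. -/
def cnot {r p : Q} (h : r ≠ p) : Equiv.Perm (Q → Fin 2) :=
  Function.Involutive.toPerm (fun x => Function.update x p (x p + x r)) fun x => by
    have h2 : ∀ a b : Fin 2, a + b + b = a := by decide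
    ext q
    rcases eq_or_ne q p with rfl | hq
    · simp [Function.update_of_ne h, h2]
    · simp [hq]

theorem cnot_apply {r p : Q} (h : r ≠ p) (x : Q → Fin 2) :
    cnot h x = Function.update x p (x p + x r) := rfl

theorem cnot_symm {r p : Q} (h : r ≠ p) : (cnot h).symm = cnot h := rfl

/-- The permutation of bit strings that acts as `π` on the bits in `S`. -/
def permOn (S : Finset Q) (π : Equiv.Perm (S → Fin 2)) : Equiv.Perm (Q → Fin 2) :=
  ((Equiv.piEquivPiSubtypeProd (fun q => q ∈ S) fun _ => Fin 2).trans
    (π.prodCongr (Equiv.refl _))).trans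
    (Equiv.piEquivPiSubtypeProd (fun q => q ∈ S) fun _ => Fin 2).symm

theorem permOn_apply_of_mem {S : Finset Q} (π : Equiv.Perm (S → Fin 2)) (x : Q → Fin 2)
    {q : Q} (hq : q ∈ S) : permOn S π x q = π (fun r => x r) ⟨q, hq⟩ := by
  simp [permOn, Equiv.piEquivPiSubtypeProd, hq]

theorem permOn_apply_of_notMem {S : Finset Q} (π : Equiv.Perm (S → Fin 2)) (x : Q → Fin 2)
    {q : Q} (hq : q ∉ S) : permOn S π x q = x q := by
  simp [permOn, Equiv.piEquivPiSubtypeProd, hq]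

theorem permOn_symm {S : Finset Q} (π : Equiv.Perm (S → Fin 2)) :
    (permOn S π).symm = permOn S π.symm := rfl

variable [Fintype Q]

theorem BipartiteCircuit.toMatrix_append (c d : BipartiteCircuit A) :
    toMatrix (c ++ d) = toMatrix d * toMatrix c := by
  induction c with
  | nil => simp [toMatrix]
  | cons g c ih =>
    change toMatrix (c ++ d) * g.toMatrix = toMatrix d * (toMatrix c * g.toMatrix)
    rw [ih, Matrix.mul_assoc]

theorem Implementable.mul {m n : ℕ} {M N : Matrix (Q → Fin 2) (Q → Fin 2) ℂ}
    (hM : Implementable A m M) (hN : Implementable A n N) : Implementable A (m + n) (M * N) := by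
  obtain ⟨c, rfl, hc⟩ := hM
  obtain ⟨d, rfl, hd⟩ := hN
  refine ⟨d ++ c, BipartiteCircuit.toMatrix_append d c, ?_⟩
  rw [BipartiteCircuit.straddlingCount_append]
  omega

theorem Implementable.mono {m n : ℕ} (h : m ≤ n) {M : Matrix (Q → Fin 2) (Q → Fin 2) ℂ}
    (hM : Implementable A m M) : Implementable A n M :=
  let ⟨c, hc, hm⟩ := hM
  ⟨c, hc, hm.trans h⟩

theorem implementable_onQubits {S : Finset Q} (hS : S ⊆ A ∨ Disjoint S A)
    {U : Matrix (S → Fin 2) (S → Fin 2) ℂ} (hU : U ∈ unitaryGroup (S → Fin 2) ℂ) :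
    Implementable A 0 (onQubits S U) :=
  ⟨[BipartiteGate.loc S hS ⟨U, hU⟩],
    by simp [BipartiteCircuit.toMatrix, BipartiteGate.toMatrix],
    by simp [BipartiteCircuit.straddlingCount, BipartiteGate.cost]⟩

theorem implementable_of_mem_range {S : Finset Q} (hS : S ⊆ A ∨ Disjoint S A)
    {U : Matrix (Q → Fin 2) (Q → Fin 2) ℂ} (hU : U ∈ unitaryGroup (Q → Fin 2) ℂ)
    (hUS : U ∈ Set.range (onQubits S)) : Implementable A 0 U := by
  obtain ⟨V, rfl⟩ := hUS
  exact implementable_onQubits hS (onQubits_mem_unitaryGroup_iff.1 hU)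

/-- Any two-qubit unitary costs one straddling gate: its determinant can be corrected by a
global phase, which is a local gate on no qubit at all. -/
theorem implementable_of_mem_range_pair {i j : Q} (hi : i ∈ A) (hj : j ∉ A)
    {U : Matrix (Q → Fin 2) (Q → Fin 2) ℂ} (hU : U ∈ unitaryGroup (Q → Fin 2) ℂ)
    (hUS : U ∈ Set.range (onQubits {i, j})) : Implementable A 1 U := by
  obtain ⟨V, rfl⟩ := hUS
  have hV := onQubits_mem_unitaryGroup_iff.1 hU
  have hij : i ≠ j := fun h => hj (h ▸ hi)
  have hcard : Fintype.card (({i, j} : Finset Q) → Fin 2) = 4 := by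
    rw [Fintype.card_fun, Fintype.card_coe, Finset.card_pair hij, Fintype.card_fin]
    norm_num
  obtain ⟨z, hz⟩ : ∃ z : ℂ, z ^ 4 = V.det :=
    IsAlgClosed.exists_pow_nat_eq _ (by norm_num)
  have hdet : ‖V.det‖ = 1 := by
    have h := (det_of_mem_unitary hV).1
    rw [Complex.star_def, Complex.conj_mul'] at h
    exact (pow_eq_one_iff_of_nonneg (norm_nonneg _) two_ne_zero).1 (by exact_mod_cast h)
  have hz1 : ‖z‖ = 1 := by
    rw [← hz, norm_pow] at hdet
    exact (pow_eq_one_iff_of_nonneg (norm_nonneg _) (by norm_num)).1 hdet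
  have hz0 : z ≠ 0 := by rintro rfl; simp at hz1
  have hzz : z * star z = 1 := by
    rw [Complex.star_def, Complex.mul_conj', hz1]; simp
  have hphase : ∀ {n : Type _} [Fintype n] [DecidableEq n] (w : ℂ), w * star w = 1 →
      w • (1 : Matrix n n ℂ) ∈ unitaryGroup n ℂ := by
    intro n _ _ w hw
    rw [mem_unitaryGroup_iff, star_smul, star_one, smul_mul_smul_comm, hw, one_mul, one_smul]
  have hW : star z • V ∈ specialUnitaryGroup (({i, j} : Finset Q) → Fin 2) ℂ := by
    rw [mem_specialUnitaryGroup_iff]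
    constructor
    · have := mul_mem (hphase (n := ({i, j} : Finset Q) → Fin 2) (star z)
        (by rw [star_star, mul_comm, hzz])) hV
      rwa [smul_mul_assoc, one_mul] at this
    · rw [det_smul, hcard, ← hz, ← mul_pow, mul_comm, hzz, one_pow]
  have h1 : Implementable A 1 (onQubits {i, j} (star z • V)) :=
    ⟨[BipartiteGate.straddling i j hi hj ⟨_, hW⟩],
      by simp [BipartiteCircuit.toMatrix, BipartiteGate.toMatrix],
      by simp [BipartiteCircuit.straddlingCount, BipartiteGate.cost]⟩
  have h2 : Implementable A 0 (onQubits ∅ (z • 1)) :=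
    implementable_onQubits (Or.inl (Finset.empty_subset A)) (hphase z hzz)
  have := h2.mul h1
  rwa [onQubits_smul, onQubits_smul, onQubits_one, smul_mul_smul_comm, hzz, one_mul, one_smul,
    zero_add] at this

theorem implementable_phaseGate {S : Finset Q} (hS : S ⊆ A ∨ Disjoint S A)
    {f : (Q → Fin 2) → ℝ} (hf : DependsOn f (S : Set Q)) : Implementable A 0 (phaseGate f) :=
  implementable_of_mem_range hS (phaseGate_mem_unitaryGroup f) (phaseGate_mem_range_onQubits hf)

theorem cnot_mem_range_onQubits {r p : Q} (h : r ≠ p) :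
    (1 : Matrix (Q → Fin 2) (Q → Fin 2) ℂ).submatrix (cnot h) id ∈
      Set.range (onQubits {r, p}) := by
  apply submatrix_one_mem_range_onQubits
  · intro x q hq
    rw [cnot_apply, Function.update_of_ne]
    rintro rfl; simp at hq
  · intro q _ x y hxy
    have hr : x r = y r := hxy r (by simp)
    have hp : x p = y p := hxy p (by simp)
    have hq' : q ∈ ({r, p} : Finset Q) := ‹_›
    simp only [cnot_apply]
    rcases eq_or_ne q p with rfl | hq
    · simp [hr, hp]
    · rw [Function.update_of_ne hq, Function.update_of_ne hq]
      exact hxy q hq'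

theorem implementable_cnot_local {r p : Q} (h : r ≠ p) (hr : r ∈ A) (hp : p ∈ A) :
    Implementable A 0 ((1 : Matrix (Q → Fin 2) (Q → Fin 2) ℂ).submatrix (cnot h) id) :=
  implementable_of_mem_range (Or.inl (by simp [Finset.insert_subset_iff, hr, hp]))
    (submatrix_one_mem_unitaryGroup _) (cnot_mem_range_onQubits h)

theorem implementable_cnot_straddling {r p : Q} (h : r ≠ p) (hr : r ∈ A) (hp : p ∉ A) :
    Implementable A 1 ((1 : Matrix (Q → Fin 2) (Q → Fin 2) ℂ).submatrix (cnot h) id) :=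
  implementable_of_mem_range_pair hr hp (submatrix_one_mem_unitaryGroup _)
    (cnot_mem_range_onQubits h)

/-- Conjugating by a CNOT turns a phase that is odd under the flip of the target into the same
phase with a sign controlled by the control qubit. -/
theorem implementable_phaseGate_of_odd {p j : Q} (hp : p ∈ A) (hj : j ∉ A)
    {θ : (Q → Fin 2) → ℝ} (hθ : DependsOn θ ((Aᶜ : Finset Q) : Set Q))
    (hodd : ∀ x, θ (Function.update x j (x j + 1)) = -θ x) :
    Implementable A 2 (phaseGate fun x => zSign (x p) * θ x) := by
  have hpj : p ≠ j := fun h => hj (h ▸ hp)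
  have : (fun x => zSign (x p) * θ x) = θ ∘ cnot hpj := by
    ext x
    rw [Function.comp, cnot_apply]
    have h2 : ∀ b : Fin 2, b = 0 ∨ b = 1 := by decide
    rcases h2 (x p) with h | h
    · simp [h, zSign]
    · simp [h, zSign, hodd]
  rw [this, phaseGate_comp, cnot_symm]
  exact ((implementable_cnot_straddling hpj hp hj).mul
    (implementable_phaseGate (Or.inr disjoint_compl_left) hθ)).mul
    (implementable_cnot_straddling hpj hp hj)

end

/-! ### Splitting a phase into odd phases -/

/-- A vector of sum zero is a coboundary for a cyclic permutation of its index set. -/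
theorem exists_perm_eq_sub {Y : Type*} [Fintype Y] (s : Y → ℝ) (hs : ∑ y, s y = 0) :
    ∃ (τ : Equiv.Perm Y) (t : Y → ℝ), ∀ y, s y = t y - t (τ y) := by
  suffices h : ∀ (n : ℕ) (s : Fin n → ℝ), ∑ y, s y = 0 →
      ∃ (τ : Equiv.Perm (Fin n)) (t : Fin n → ℝ), ∀ y, s y = t y - t (τ y) by
    let e := Fintype.equivFin Y
    obtain ⟨τ, t, ht⟩ := h _ (s ∘ e.symm) (by rw [← hs]; exact e.symm.sum_comp s)
    refine ⟨(e.trans τ).trans e.symm, t ∘ e, fun y => ?_⟩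
    simpa using ht (e y)
  intro n s hs
  rcases n with _ | n
  · exact ⟨1, 0, fun y => y.elim0⟩
  refine ⟨finRotate (n + 1), fun i => -∑ j ∈ Finset.univ.filter (· < i), s j, fun y => ?_⟩
  induction y using Fin.lastCases with
  | last =>
    rw [finRotate_last]
    have h0 : Finset.univ.filter (· < (0 : Fin (n + 1))) = ∅ := by ext; simp
    have h1 : Finset.univ.filter (· < Fin.last n) = Finset.univ.erase (Fin.last n) := by
      ext x; simp [Fin.lt_last_iff_ne_last]
    have := Finset.add_sum_erase Finset.univ s (Finset.mem_univ (Fin.last n))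
    dsimp only
    rw [h0, h1, Finset.sum_empty]
    linarith
  | cast i =>
    have hrot : finRotate (n + 1) i.castSucc = i.succ := by
      simp
    have h1 : Finset.univ.filter (· < i.succ) =
        insert i.castSucc (Finset.univ.filter (· < i.castSucc)) := by
      ext x
      simp [Fin.lt_def, Fin.ext_iff]
      omega
    dsimp only
    rw [hrot, h1, Finset.sum_insert (by simp)]
    ring

/-- A zero-sum function on `Fin 2 × Y` is a sum of two functions, each of which changes sign under
a perfect matching of `Fin 2 × Y`: two such matchings can be chosen to form a cycle through all
points, and on a connected graph every zero-sum function is the divergence of a flow. -/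
theorem exists_odd_add_odd {Y : Type*} [Fintype Y] (φ : Fin 2 × Y → ℝ) (hφ : ∑ z, φ z = 0) :
    ∃ (σ : Equiv.Perm (Fin 2 × Y)) (φ₁ φ₂ : Fin 2 × Y → ℝ),
      (∀ b y, φ₁ (b + 1, y) = -φ₁ (b, y)) ∧ (∀ b y, φ₂ (b + 1, y) = -φ₂ (b, y)) ∧
      ∀ z, φ z = φ₁ z + φ₂ (σ z) := by
  obtain ⟨τ, t, ht⟩ := exists_perm_eq_sub (fun y => φ (0, y) + φ (1, y)) (by
    rw [Finset.sum_add_distrib, ← hφ, Fintype.sum_prod_type, Fin.sum_univ_two])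
  let π : Fin 2 → Equiv.Perm Y := ![τ, 1]
  let φ₂ : Fin 2 × Y → ℝ := fun z => -(zSign z.1 * t z.2)
  let σ : Equiv.Perm (Fin 2 × Y) := Equiv.prodShear (Equiv.refl _) π
  have h2 : ∀ b : Fin 2, b = 0 ∨ b = 1 := by decide
  refine ⟨σ, fun z => φ z - φ₂ (σ z), φ₂, ?_, ?_, fun z => by ring⟩
  · intro b y
    have := ht y
    rcases h2 b with rfl | rfl <;> simp [σ, φ₂, π, zSign] <;> linarith
  · intro b y
    rcases h2 b with rfl | rfl <;> simp [φ₂, zSign]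

/-! ### The upper bound -/

section

variable {Q : Type*} [Fintype Q] [DecidableEq Q] {A : Finset Q}

open Matrix

theorem implementable_permOn {S : Finset Q} (hS : S ⊆ A ∨ Disjoint S A)
    (π : Equiv.Perm (S → Fin 2)) :
    Implementable A 0 ((1 : Matrix (Q → Fin 2) (Q → Fin 2) ℂ).submatrix (permOn S π) id) := by
  refine implementable_of_mem_range hS (submatrix_one_mem_unitaryGroup _)
    (submatrix_one_mem_range_onQubits (fun x q hq => permOn_apply_of_notMem π x hq) ?_)
  intro q hq x y hxy
  have hxy' : (fun r : S => x r) = fun r : S => y r := funext fun r => hxy r r.2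
  simp only [permOn_apply_of_mem π _ hq, hxy']

/-- A phase on one side, with a sign controlled by a single qubit of the other side, costs a
bounded number of straddling gates. -/
theorem implementable_signed_phaseGate {p : Q} (hp : p ∈ A) (hA : Aᶜ.Nonempty)
    {θ : (Q → Fin 2) → ℝ} (hθ : DependsOn θ ((Aᶜ : Finset Q) : Set Q)) :
    Implementable A 4 (phaseGate fun x => zSign (x p) * θ x) := by
  obtain ⟨j, hj⟩ := hA
  have hdisj : Disjoint Aᶜ A := disjoint_compl_left
  obtain ⟨φ, rfl⟩ := dependsOn_iff_exists_comp.1 hθ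
  set r : (Q → Fin 2) → ((Aᶜ : Finset Q) → Fin 2) := fun x q => x q with hr
  let e : ((Aᶜ : Finset Q) → Fin 2) ≃ _ := Equiv.funSplitAt (⟨j, hj⟩ : (Aᶜ : Finset Q)) (Fin 2)
  let c : ℝ := (∑ z, φ (e.symm z)) /
    Fintype.card (Fin 2 × ({q : (Aᶜ : Finset Q) // q ≠ ⟨j, hj⟩} → Fin 2))
  obtain ⟨σ, φ₁, φ₂, h₁, h₂, hφ⟩ := exists_odd_add_odd (fun z => φ (e.symm z) - c) (by
    rw [Finset.sum_sub_distrib, Finset.sum_const, Finset.card_univ, nsmul_eq_mul]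
    simp only [c]
    rw [mul_div_cancel₀, sub_self]
    exact_mod_cast Fintype.card_ne_zero)
  have hdep : ∀ ψ : Fin 2 × ({q : (Aᶜ : Finset Q) // q ≠ ⟨j, hj⟩} → Fin 2) → ℝ,
      DependsOn (fun x => ψ (e (r x))) ((Aᶜ : Finset Q) : Set Q) := by
    intro ψ x y hxy
    have : r x = r y := funext fun q => hxy q q.2
    simp only [this]
  have hodd : ∀ ψ : Fin 2 × ({q : (Aᶜ : Finset Q) // q ≠ ⟨j, hj⟩} → Fin 2) → ℝ,
      (∀ b y, ψ (b + 1, y) = -ψ (b, y)) → ∀ x : Q → Fin 2,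
        ψ (e (r (Function.update x j (x j + 1)))) = -ψ (e (r x)) := by
    intro ψ hψ x
    have h1 : e (r (Function.update x j (x j + 1))) = ((e (r x)).1 + 1, (e (r x)).2) := by
      ext q
      · simp [e, hr, Equiv.funSplitAt]
      · have hq : ((q : (Aᶜ : Finset Q)) : Q) ≠ j := fun h => q.2 (Subtype.ext h)
        simp [e, hr, Equiv.funSplitAt, Function.update_of_ne hq]
    rw [h1, hψ]
  let π : Equiv.Perm ((Aᶜ : Finset Q) → Fin 2) := (e.trans σ).trans e.symm
  have hπ : ∀ x, r (permOn Aᶜ π x) = π (r x) := fun x =>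
    funext fun q => permOn_apply_of_mem π x q.2
  have hsplit : (fun x => zSign (x p) * (φ ∘ Set.domRestrict ((Aᶜ : Finset Q) : Set Q)) x) =
      (fun x => zSign (x p) * c) + (fun x => zSign (x p) * φ₁ (e (r x))) +
        (fun x => zSign (x p) * φ₂ (e (r x))) ∘ permOn Aᶜ π := by
    ext x
    have h3 := hφ (e (r x))
    rw [Equiv.symm_apply_apply] at h3
    have h4 : permOn Aᶜ π x p = x p := permOn_apply_of_notMem π x (by simpa using hp)
    have h5 : e (π (r x)) = σ (e (r x)) := by simp [π]
    simp only [Pi.add_apply, Function.comp, hπ, h4, h5]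
    rw [← mul_add, ← mul_add]
    congr 1
    change φ (r x) = _
    linarith
  rw [hsplit, phaseGate_add, phaseGate_add, phaseGate_comp, permOn_symm]
  have hc : Implementable A 0 (phaseGate fun x : Q → Fin 2 => zSign (x p) * c) :=
    implementable_phaseGate (Or.inl subset_rfl) fun x y hxy => by rw [hxy p hp]
  have hjA : j ∉ A := by simpa using hj
  exact (hc.mul (implementable_phaseGate_of_odd hp hjA (hdep φ₁) (hodd φ₁ h₁))).mul
    (((implementable_permOn (Or.inr hdisj) π).mul
      (implementable_phaseGate_of_odd hp hjA (hdep φ₂) (hodd φ₂ h₂))).mul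
      (implementable_permOn (Or.inr hdisj) π.symm))

/-- A multiplexed rotation controlled by `T ⊆ A` and by all of the other side: expanding the angle
in characters of the bits in `T` leaves `2 ^ |T|` rotations controlled by the other side only. -/
theorem implementable_multiplexed_phaseGate (hA : Aᶜ.Nonempty) {p : Q} (hp : p ∈ A)
    (T : Finset Q) (hT : T ⊆ A) (hpT : p ∉ T) {θ : (Q → Fin 2) → ℝ}
    (hθ : DependsOn θ ((T ∪ Aᶜ : Finset Q) : Set Q)) :
    Implementable A (4 * 2 ^ T.card) (phaseGate fun x => zSign (x p) * θ x) := by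
  induction T using Finset.induction_on generalizing θ with
  | empty => exact implementable_signed_phaseGate hp hA (by simpa using hθ)
  | insert r T hr ih =>
    have hrA : r ∈ A := hT (Finset.mem_insert_self r T)
    have hrp : r ≠ p := by rintro rfl; simp at hpT
    have hpT' : p ∉ T := fun h => hpT (Finset.mem_insert_of_mem h)
    have hTA : T ⊆ A := (Finset.subset_insert r T).trans hT
    have hdep : ∀ b : Fin 2, DependsOn (fun x => θ (Function.update x r b))
        ((T ∪ Aᶜ : Finset Q) : Set Q) := by
      intro b x y hxy
      apply hθ
      intro q hq
      rcases eq_or_ne q r with rfl | hqr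
      · simp
      · rw [Function.update_of_ne hqr, Function.update_of_ne hqr]
        apply hxy
        simpa [hqr] using hq
    let θe : (Q → Fin 2) → ℝ := fun x => (θ (Function.update x r 0) + θ (Function.update x r 1)) / 2
    let θo : (Q → Fin 2) → ℝ := fun x => (θ (Function.update x r 0) - θ (Function.update x r 1)) / 2
    have he : DependsOn θe ((T ∪ Aᶜ : Finset Q) : Set Q) := fun x y hxy => by
      have h0 := hdep 0 hxy
      have h1 := hdep 1 hxy
      simp only at h0 h1
      simp only [θe, h0, h1]
    have ho : DependsOn θo ((T ∪ Aᶜ : Finset Q) : Set Q) := fun x y hxy => by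
      have h0 := hdep 0 hxy
      have h1 := hdep 1 hxy
      simp only at h0 h1
      simp only [θo, h0, h1]
    have hsplit : (fun x => zSign (x p) * θ x) = (fun x => zSign (x p) * θe x) +
        (fun x => zSign (x p) * θo x) ∘ cnot hrp := by
      ext x
      have h1 : θo (cnot hrp x) = θo x := by
        apply ho
        intro q hq
        rw [cnot_apply, Function.update_of_ne]
        rintro rfl
        simp [hpT', hp] at hq
      have h2 : ∀ b : Fin 2, b = 0 ∨ b = 1 := by decide
      have h3 : zSign (cnot hrp x p) = zSign (x p) * zSign (x r) := by
        rw [cnot_apply, Function.update_self]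
        rcases h2 (x p) with h | h <;> rcases h2 (x r) with h' | h' <;> simp [h, h', zSign]
      have h4 : θ x = θ (Function.update x r (x r)) := by rw [Function.update_eq_self]
      simp only [Pi.add_apply, Function.comp, h1, h3]
      rw [h4]
      rcases h2 (x r) with h' | h' <;> simp only [h', zSign_zero, zSign_one, θe, θo] <;> ring
    rw [hsplit, phaseGate_add, phaseGate_comp, cnot_symm, Finset.card_insert_of_notMem hr]
    have hc := implementable_cnot_local hrp hrA hp
    refine ((ih hTA hpT' he).mul ((hc.mul (ih hTA hpT' ho)).mul hc)).mono ?_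
    rw [pow_succ]
    omega

/-- Unitaries on the qubits of the other side and of `T ⊆ A`, by induction on `T`: the cosine-sine
decomposition and demultiplexing split off one qubit, at the cost of four unitaries of the same
kind on `T` minus this qubit and of three multiplexed rotations. -/
theorem implementable_onQubits_union_compl (T : Finset Q) (hT : T ⊆ A)
    (hA : A.Nonempty → Aᶜ.Nonempty)
    {U : Matrix (↥(T ∪ Aᶜ) → Fin 2) (↥(T ∪ Aᶜ) → Fin 2) ℂ}
    (hU : U ∈ unitaryGroup (↥(T ∪ Aᶜ) → Fin 2) ℂ) :
    ∃ m, m + 6 * 2 ^ T.card ≤ 6 * 4 ^ T.card ∧ Implementable A m (onQubits (T ∪ Aᶜ) U) := by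
  obtain ⟨k, hk, hdec⟩ := exists_multiplexed_decomposition
  suffices h : ∃ m, m + 6 * 2 ^ T.card ≤ 6 * 4 ^ T.card ∧
      ∀ U ∈ unitaryGroup (↥(T ∪ Aᶜ) → Fin 2) ℂ, Implementable A m (onQubits (T ∪ Aᶜ) U) by
    obtain ⟨m, hm, h⟩ := h
    exact ⟨m, hm, h U hU⟩
  clear hU U
  induction T using Finset.induction_on with
  | empty =>
    refine ⟨0, by simp, fun U hU => implementable_onQubits (Or.inr ?_) hU⟩
    rw [Finset.empty_union]
    exact disjoint_compl_left
  | insert q T hq ih =>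
    have hqA : q ∈ A := hT (Finset.mem_insert_self q T)
    have hTA : T ⊆ A := (Finset.subset_insert q T).trans hT
    obtain ⟨m, hm, ih⟩ := ih hTA
    have hqS : q ∉ T ∪ Aᶜ := by simp [hq, hqA]
    refine ⟨4 * m + 3 * (4 * 2 ^ T.card), ?_, ?_⟩
    · rw [Finset.card_insert_of_notMem hq, pow_succ, pow_succ]
      omega
    rw [Finset.insert_union]
    intro U hU
    obtain ⟨M, rfl⟩ : ∃ M, U = M.submatrix (splitQubit hqS) (splitQubit hqS) :=
      ⟨U.submatrix (splitQubit hqS).symm (splitQubit hqS).symm, by simp⟩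
    have hM : M ∈ unitaryGroup _ ℂ := by
      rw [mem_unitaryGroup_iff, star_eq_conjTranspose] at hU ⊢
      rw [conjTranspose_submatrix, submatrix_mul_equiv] at hU
      apply (reindex (splitQubit hqS).symm (splitQubit hqS).symm).injective
      simpa using hU
    obtain ⟨V₁, hV₁, V₂, hV₂, V₃, hV₃, V₄, hV₄, θ₁, θ₂, θ₃, rfl⟩ := hdec hM
    simp only [← submatrix_mul_equiv _ _ _ (splitQubit hqS), onQubits_mul,
      onQubits_insert_fromBlocks, onQubits_insert_phaseBlocks, onQubits_insert_qubitBlocks]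
    have hrot : ∀ θ : (↥(T ∪ Aᶜ) → Fin 2) → ℝ, Implementable A (4 * 2 ^ T.card)
        (phaseGate fun x : Q → Fin 2 => zSign (x q) * θ fun r => x r) := fun θ =>
      implementable_multiplexed_phaseGate (hA ⟨q, hqA⟩) hqA T hTA hq fun x y hxy => by
        have : (fun r : ↥(T ∪ Aᶜ) => x r) = fun r : ↥(T ∪ Aᶜ) => y r := funext fun r => hxy r r.2
        rw [this]
    have hloc : ∀ k ∈ unitaryGroup (Fin 2) ℂ, Implementable A 0 (onQubits {q}
        (k.submatrix (fun x => x ⟨q, Finset.mem_singleton_self q⟩)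
          fun x => x ⟨q, Finset.mem_singleton_self q⟩)) := by
      intro k hk
      refine implementable_onQubits (Or.inl (by simpa using hqA)) ?_
      let e : (({q} : Finset Q) → Fin 2) ≃ Fin 2 :=
        Equiv.funUnique ({q} : Finset Q) (Fin 2)
      have : k.submatrix e e ∈ unitaryGroup _ ℂ := by
        rw [mem_unitaryGroup_iff, star_eq_conjTranspose] at hk ⊢
        rw [conjTranspose_submatrix, submatrix_mul_equiv, hk, submatrix_one_equiv]
      exact this
    refine (((((ih V₁ hV₁).mul (hrot θ₁)).mul (ih V₂ hV₂)).mul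
      (((hloc k hk).mul (hrot θ₂)).mul (hloc _ (Unitary.star_mem hk)))).mul
      (((ih V₃ hV₃).mul (hrot θ₃)).mul (ih V₄ hV₄))).mono ?_
    omega

theorem implementable_of_card_le (hA : A.card ≤ Aᶜ.card)
    {U : Matrix (Q → Fin 2) (Q → Fin 2) ℂ} (hU : U ∈ unitaryGroup (Q → Fin 2) ℂ) :
    Implementable A (6 * 4 ^ A.card) U := by
  obtain ⟨V, rfl⟩ : U ∈ Set.range (onQubits (A ∪ Aᶜ)) := by
    apply mem_range_onQubits
    · intro x y q hq
      simp at hq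
    · intro x y x' y' _ _ h3 h4
      rw [show x = x' from funext fun q => h3 q (by simp),
        show y = y' from funext fun q => h4 q (by simp)]
  obtain ⟨m, hm, h⟩ := implementable_onQubits_union_compl A subset_rfl
    (fun h => Finset.card_pos.1 (h.card_pos.trans_le hA)) (onQubits_mem_unitaryGroup_iff.1 hU)
  exact h.mono (by omega)

end

/-! ### Countable unions of smooth images -/

/-- `X` is contained in a countable union of ranges of `C¹` maps with `d` complex parameters. -/
def HasSmoothCover {E : Type*} [NormedAddCommGroup E] [NormedSpace ℂ E] (d : ℕ) (X : Set E) :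
    Prop :=
  ∃ (ι : Type) (_ : Countable ι) (f : ι → (Fin d → ℂ) → E),
    (∀ i, ContDiff ℂ 1 (f i)) ∧ X ⊆ ⋃ i, Set.range (f i)

namespace HasSmoothCover

section

variable {E : Type*} [NormedAddCommGroup E] [NormedSpace ℂ E] {d d₁ d₂ : ℕ} {X Y : Set E}

theorem mono (h : HasSmoothCover d Y) (hXY : X ⊆ Y) : HasSmoothCover d X :=
  let ⟨ι, hι, f, hf, hY⟩ := h
  ⟨ι, hι, f, hf, hXY.trans hY⟩

theorem mono_dim (h : HasSmoothCover d₁ X) (hd : d₁ ≤ d₂) : HasSmoothCover d₂ X := by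
  obtain ⟨ι, hι, f, hf, hX⟩ := h
  refine ⟨ι, hι, fun i z => f i fun k => z (Fin.castLE hd k),
    fun i => (hf i).comp (contDiff_pi.2 fun k => contDiff_apply ℂ ℂ _), hX.trans ?_⟩
  refine Set.iUnion_mono fun i => ?_
  rintro _ ⟨z, rfl⟩
  refine ⟨fun k => if h : (k : ℕ) < d₁ then z ⟨k, h⟩ else 0, ?_⟩
  simp

theorem range_linearMap {V : Type*} [AddCommGroup V] [Module ℂ V] [FiniteDimensional ℂ V]
    (L : V →ₗ[ℂ] E) : HasSmoothCover (Module.finrank ℂ V) (Set.range L) := by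
  let e := (Module.finBasis ℂ V).equivFun
  refine ⟨Unit, inferInstance, fun _ z => L (e.symm z), fun _ => ?_, ?_⟩
  · exact (LinearMap.toContinuousLinearMap (L ∘ₗ e.symm.toLinearMap)).contDiff
  · rintro _ ⟨v, rfl⟩
    exact Set.mem_iUnion.2 ⟨(), e v, by simp⟩

theorem iUnion {κ : Type} [Countable κ] {X : κ → Set E} (h : ∀ k, HasSmoothCover d (X k)) :
    HasSmoothCover d (⋃ k, X k) := by
  choose ι hι f hf hX using h
  refine ⟨Σ k, ι k, inferInstance, fun i => f i.1 i.2, fun i => hf i.1 i.2, ?_⟩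
  refine Set.iUnion_subset fun k x hx => ?_
  obtain ⟨i, hi⟩ := Set.mem_iUnion.1 (hX k hx)
  exact Set.mem_iUnion.2 ⟨⟨k, i⟩, hi⟩

theorem image2 {op : E → E → E} (hop : ContDiff ℂ 1 fun p : E × E => op p.1 p.2)
    (hX : HasSmoothCover d₁ X) (hY : HasSmoothCover d₂ Y) :
    HasSmoothCover (d₁ + d₂) (Set.image2 op X Y) := by
  obtain ⟨ι, hι, f, hf, hX⟩ := hX
  obtain ⟨κ, hκ, g, hg, hY⟩ := hY
  refine ⟨ι × κ, inferInstance, fun i z => op (f i.1 fun k => z (Fin.castAdd d₂ k))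
    (g i.2 fun k => z (Fin.natAdd d₁ k)), fun i => ?_, ?_⟩
  · exact hop.comp (((hf i.1).comp (contDiff_pi.2 fun k => contDiff_apply ℂ ℂ _)).prodMk
      ((hg i.2).comp (contDiff_pi.2 fun k => contDiff_apply ℂ ℂ _)))
  · rintro _ ⟨x, hx, y, hy, rfl⟩
    obtain ⟨i, a, rfl⟩ := Set.mem_iUnion.1 (hX hx)
    obtain ⟨j, b, rfl⟩ := Set.mem_iUnion.1 (hY hy)
    exact Set.mem_iUnion.2 ⟨(i, j), Fin.append a b, by simp⟩

/-- Smooth maps do not raise the Hausdorff dimension. -/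
theorem finrank_le [FiniteDimensional ℂ E] (h : HasSmoothCover d (Set.univ : Set E)) :
    Module.finrank ℂ E ≤ d := by
  obtain ⟨ι, hι, f, hf, hX⟩ := h
  have : FiniteDimensional ℝ E := FiniteDimensional.complexToReal E
  have h1 : dimH (Set.univ : Set E) ≤ ((2 * d : ℕ) : ENNReal) := by
    refine (dimH_mono hX).trans ?_
    rw [dimH_iUnion]
    refine iSup_le fun i => ?_
    refine ((hf i).restrict_scalars ℝ).dimH_range_le.trans ?_
    rw [finrank_real_of_complex, Module.finrank_fin_fun]
  rw [Real.dimH_univ_eq_finrank, finrank_real_of_complex] at h1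
  have h2 : 2 * Module.finrank ℂ E ≤ 2 * d := by exact_mod_cast h1
  omega

end

theorem mul {E : Type*} [NormedRing E] [NormedAlgebra ℂ E] {d₁ d₂ : ℕ} {X Y : Set E}
    (hX : HasSmoothCover d₁ X) (hY : HasSmoothCover d₂ Y) :
    HasSmoothCover (d₁ + d₂) (Set.image2 (· * ·) X Y) :=
  image2 (contDiff_fst.mul contDiff_snd) hX hY

theorem add {E : Type*} [NormedAddCommGroup E] [NormedSpace ℂ E] {d₁ d₂ : ℕ} {X Y : Set E}
    (hX : HasSmoothCover d₁ X) (hY : HasSmoothCover d₂ Y) :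
    HasSmoothCover (d₁ + d₂) (Set.image2 (· + ·) X Y) :=
  image2 (contDiff_fst.add contDiff_snd) hX hY

/-- Since every element is a combination of four unitaries, a cover of the unitary group needs
about a quarter of the dimension of the algebra. -/
theorem finrank_le_of_unitary {E : Type*} [CStarAlgebra E] [FiniteDimensional ℂ E] {d : ℕ}
    (h : HasSmoothCover d (unitary E : Set E)) : Module.finrank ℂ E ≤ 4 * (d + 1) := by
  have h1 : HasSmoothCover (1 + d) (Set.image2 (· * ·)
      (Set.range (LinearMap.toSpanSingleton ℂ E 1)) (unitary E : Set E)) := by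
    have := range_linearMap (LinearMap.toSpanSingleton ℂ E 1)
    rw [Module.finrank_self] at this
    exact this.mul h
  have h2 := ((h1.add h1).add h1).add h1
  have h3 := (h2.mono (X := Set.univ) ?_).finrank_le
  · omega
  · intro x _
    obtain ⟨u, c, rfl, -⟩ := CStarAlgebra.exists_sum_four_unitary x
    have hu : ∀ i, c i • (u i : E) ∈ Set.image2 (· * ·)
        (Set.range (LinearMap.toSpanSingleton ℂ E 1)) (unitary E : Set E) := fun i =>
      ⟨c i • 1, ⟨c i, by simp⟩, u i, (u i).2, by simp⟩
    rw [Fin.sum_univ_four]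
    exact Set.mem_image2_of_mem (Set.mem_image2_of_mem (Set.mem_image2_of_mem (hu 0) (hu 1)) (hu 2))
      (hu 3)

end HasSmoothCover

/-! ### The lower bound -/

section

variable {Q : Type} [Fintype Q] [DecidableEq Q]

open Matrix

theorem onQubits_mul_onQubits_apply {S T : Finset Q} (hST : ∀ q, q ∈ S ↔ q ∉ T)
    (a : Matrix (S → Fin 2) (S → Fin 2) ℂ) (b : Matrix (T → Fin 2) (T → Fin 2) ℂ)
    (x y : Q → Fin 2) :
    (onQubits S a * onQubits T b) x y =
      a (fun q => x q) (fun q => y q) * b (fun q => x q) (fun q => y q) := by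
  have hTS : ∀ q, q ∈ T ↔ q ∉ S := fun q => by rw [hST, not_not]
  rw [mul_apply, Finset.sum_eq_single fun q => if q ∈ S then y q else x q]
  · have hS : (fun q : S => if (q : Q) ∈ S then y q else x q) = fun q : S => y q :=
      funext fun q => if_pos q.2
    have hT : (fun q : T => if (q : Q) ∈ S then y q else x q) = fun q : T => x q :=
      funext fun q => if_neg ((hTS q).1 q.2)
    simp only [onQubits, of_apply, hS, hT]
    rw [if_pos fun q hq => (if_neg hq).symm, if_pos fun q hq => if_pos ((hST q).2 hq)]
  · intro z _ hz
    simp only [onQubits, of_apply]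
    by_cases h1 : ∀ q ∉ S, x q = z q
    · by_cases h2 : ∀ q ∉ T, z q = y q
      · refine absurd (funext fun q => ?_) hz
        split_ifs with hq
        · exact h2 q ((hST q).1 hq)
        · exact (h1 q hq).symm
      · rw [if_neg h2, mul_zero]
    · rw [if_neg h1, zero_mul]
  · simp

theorem onQubits_compl_comm (A : Finset Q) (a : Matrix (A → Fin 2) (A → Fin 2) ℂ)
    (b : Matrix (↥Aᶜ → Fin 2) (↥Aᶜ → Fin 2) ℂ) :
    onQubits A a * onQubits Aᶜ b = onQubits Aᶜ b * onQubits A a := by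
  ext x y
  rw [onQubits_mul_onQubits_apply (by simp), onQubits_mul_onQubits_apply (by simp), mul_comm]

/-- `onQubits` as a linear map. -/
def onQubitsLinearMap (S : Finset Q) :
    Matrix (S → Fin 2) (S → Fin 2) ℂ →ₗ[ℂ] Matrix (Q → Fin 2) (Q → Fin 2) ℂ where
  toFun := onQubits S
  map_add' := onQubits_add S
  map_smul' := onQubits_smul S

/-- The product operators `a ⊗ b`. -/
def productOperators (A : Finset Q) : Set (Matrix (Q → Fin 2) (Q → Fin 2) ℂ) :=
  Set.image2 (· * ·) (Set.range (onQubits A)) (Set.range (onQubits Aᶜ))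

/-- The operators acting on two qubits. -/
def twoQubitOperators (Q : Type) [Fintype Q] [DecidableEq Q] :
    Set (Matrix (Q → Fin 2) (Q → Fin 2) ℂ) :=
  ⋃ p : {p : Q × Q // p.1 ≠ p.2}, Set.range (onQubits {p.1.1, p.1.2})

/-- The products of `s + 1` product operators, alternating with `s` two-qubit operators. -/
def alternatingProducts (A : Finset Q) : ℕ → Set (Matrix (Q → Fin 2) (Q → Fin 2) ℂ)
  | 0 => productOperators A
  | s + 1 => Set.image2 (· * ·) (alternatingProducts A s)
      (Set.image2 (· * ·) (twoQubitOperators Q) (productOperators A))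

variable {A : Finset Q}

theorem one_mem_productOperators : 1 ∈ productOperators A :=
  ⟨1, ⟨1, onQubits_one A⟩, 1, ⟨1, onQubits_one Aᶜ⟩, mul_one 1⟩

theorem mul_onQubits_mem_productOperators {S : Finset Q} (hS : S ⊆ A ∨ Disjoint S A)
    (U : Matrix (S → Fin 2) (S → Fin 2) ℂ) {M : Matrix (Q → Fin 2) (Q → Fin 2) ℂ}
    (hM : M ∈ productOperators A) : M * onQubits S U ∈ productOperators A := by
  obtain ⟨_, ⟨a, rfl⟩, _, ⟨b, rfl⟩, rfl⟩ := hM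
  rcases hS with hS | hS
  · obtain ⟨c, hc⟩ := range_onQubits_mono hS ⟨U, rfl⟩
    refine ⟨_, ⟨a * c, rfl⟩, _, ⟨b, rfl⟩, ?_⟩
    dsimp only
    rw [← hc, onQubits_mul, mul_assoc, mul_assoc, onQubits_compl_comm]
  · obtain ⟨c, hc⟩ := range_onQubits_mono (le_compl_iff_disjoint_right.2 hS) ⟨U, rfl⟩
    refine ⟨_, ⟨a, rfl⟩, _, ⟨b * c, rfl⟩, ?_⟩
    dsimp only
    rw [← hc, onQubits_mul, mul_assoc]

theorem mul_onQubits_mem_alternatingProducts {S : Finset Q} (hS : S ⊆ A ∨ Disjoint S A)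
    (U : Matrix (S → Fin 2) (S → Fin 2) ℂ) {s : ℕ} {M : Matrix (Q → Fin 2) (Q → Fin 2) ℂ}
    (hM : M ∈ alternatingProducts A s) : M * onQubits S U ∈ alternatingProducts A s := by
  cases s with
  | zero => exact mul_onQubits_mem_productOperators hS U hM
  | succ s =>
    obtain ⟨X, hX, _, ⟨G, hG, L, hL, rfl⟩, rfl⟩ := hM
    refine ⟨X, hX, _, ⟨G, hG, _, mul_onQubits_mem_productOperators hS U hL, rfl⟩, ?_⟩
    simp only [mul_assoc]

/-- Local gates merge into the product operators between the straddling gates, so that a circuit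
with `s` straddling gates has a normal form whose number of parameters depends on `s` only. -/
theorem BipartiteCircuit.toMatrix_mem_alternatingProducts (c : BipartiteCircuit A) :
    c.toMatrix ∈ alternatingProducts A c.straddlingCount := by
  induction c with
  | nil => exact one_mem_productOperators
  | cons g c ih =>
    cases g with
    | loc S hS U => exact mul_onQubits_mem_alternatingProducts hS _ ih
    | straddling i j hi hj g =>
      refine ⟨_, ih, _, ⟨onQubits {i, j} g, ?_, 1, one_mem_productOperators, mul_one _⟩, rfl⟩
      exact Set.mem_iUnion.2 ⟨⟨(i, j), ne_of_mem_of_not_mem hi hj⟩, _, rfl⟩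

open scoped Matrix.Norms.L2Operator

theorem hasSmoothCover_range_onQubits (S : Finset Q) :
    HasSmoothCover (4 ^ S.card) (Set.range (onQubits S)) := by
  have h := HasSmoothCover.range_linearMap (onQubitsLinearMap S)
  have h4 : Module.finrank ℂ (Matrix (S → Fin 2) (S → Fin 2) ℂ) = 4 ^ S.card := by
    rw [Module.finrank_matrix, Module.finrank_self, Fintype.card_fun, Fintype.card_coe,
      Fintype.card_fin, mul_one, ← mul_pow]
    norm_num
  rwa [h4] at h

theorem hasSmoothCover_alternatingProducts (A : Finset Q) (s : ℕ) :
    HasSmoothCover ((s + 1) * (4 ^ A.card + 4 ^ Aᶜ.card) + 16 * s) (alternatingProducts A s) := by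
  have hL : HasSmoothCover (4 ^ A.card + 4 ^ Aᶜ.card) (productOperators A) :=
    (hasSmoothCover_range_onQubits A).mul (hasSmoothCover_range_onQubits Aᶜ)
  have hG : HasSmoothCover 16 (twoQubitOperators Q) := by
    refine HasSmoothCover.iUnion fun p => ?_
    have := hasSmoothCover_range_onQubits ({p.1.1, p.1.2} : Finset Q)
    rwa [Finset.card_pair p.2] at this
  induction s with
  | zero => simpa using! hL
  | succ s ih =>
    refine (ih.mul (hG.mul hL)).mono_dim (le_of_eq ?_)
    ring

/-- Counting parameters: few straddling gates cannot produce all unitaries. -/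
theorem card_bound_of_circuits {m : ℕ}
    (h : ∀ U ∈ unitaryGroup (Q → Fin 2) ℂ, ∃ c : BipartiteCircuit A, c.toMatrix = U ∧
      c.straddlingCount ≤ m) :
    4 ^ Fintype.card Q ≤ 4 * ((m + 1) * (4 ^ A.card + 4 ^ Aᶜ.card) + 16 * m + 1) := by
  have h4 : Module.finrank ℂ (Matrix (Q → Fin 2) (Q → Fin 2) ℂ) = 4 ^ Fintype.card Q := by
    rw [Module.finrank_matrix, Module.finrank_self, Fintype.card_fun, Fintype.card_fin, mul_one,
      ← mul_pow]
    norm_num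
  rw [← h4]
  apply HasSmoothCover.finrank_le_of_unitary
  refine (HasSmoothCover.iUnion (κ := Fin (m + 1)) (X := fun s => alternatingProducts A s)
    fun s => (hasSmoothCover_alternatingProducts A s).mono_dim ?_).mono ?_
  · have : (s : ℕ) ≤ m := Nat.lt_succ_iff.1 s.2
    gcongr
  · intro U hU
    obtain ⟨c, rfl, hc⟩ := h U hU
    exact Set.mem_iUnion.2 ⟨⟨c.straddlingCount, Nat.lt_succ_iff.2 hc⟩,
      c.toMatrix_mem_alternatingProducts⟩

/-- A controlled phase between the two sides is not a product operator. -/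
theorem exists_unitary_notMem_productOperators (hA : A.Nonempty) (hA' : Aᶜ.Nonempty) :
    ∃ U ∈ unitaryGroup (Q → Fin 2) ℂ, U ∉ productOperators A := by
  obtain ⟨i, hi⟩ := hA
  obtain ⟨j, hj⟩ := hA'
  have hj' : j ∉ A := by simpa using hj
  let f : (Q → Fin 2) → ℝ := fun x => if x i = 1 ∧ x j = 1 then Real.pi else 0
  refine ⟨phaseGate f, phaseGate_mem_unitaryGroup f, ?_⟩
  rintro ⟨_, ⟨a, rfl⟩, _, ⟨b, rfl⟩, h⟩
  dsimp only at h
  -- the diagonal entries at the strings that are constant on each side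
  have key : ∀ u v : Fin 2, a (fun _ => u) (fun _ => u) * b (fun _ => v) (fun _ => v) =
      if u = 1 ∧ v = 1 then -1 else 1 := by
    intro u v
    have h1 := congrFun (congrFun h fun q => if q ∈ A then u else v) fun q => if q ∈ A then u else v
    rw [onQubits_mul_onQubits_apply (by simp)] at h1
    have hb : (fun q : ↥Aᶜ => if (q : Q) ∈ A then u else v) = fun _ => v :=
      funext fun q => if_neg (Finset.mem_compl.1 q.2)
    have ha : (fun q : A => if (q : Q) ∈ A then u else v) = fun _ => u :=
      funext fun q => if_pos q.2
    rw [ha, hb] at h1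
    rw [h1, phaseGate, diagonal_apply_eq]
    simp only [f, if_pos hi, if_neg hj']
    split_ifs <;> simp
  have h00 := key 0 0
  have h01 := key 0 1
  have h10 := key 1 0
  have h11 := key 1 1
  simp only [zero_ne_one, false_and, and_false, if_false, and_self, if_true] at h00 h01 h10 h11
  have : (1 : ℂ) = -1 := by
    calc (1 : ℂ) = (a (fun _ => 0) (fun _ => 0) * b (fun _ => 1) (fun _ => 1)) *
          (a (fun _ => 1) (fun _ => 1) * b (fun _ => 0) (fun _ => 0)) := by rw [h01, h10, one_mul]
      _ = (a (fun _ => 0) (fun _ => 0) * b (fun _ => 0) (fun _ => 0)) *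
          (a (fun _ => 1) (fun _ => 1) * b (fun _ => 1) (fun _ => 1)) := by ring
      _ = -1 := by rw [h00, h11, one_mul]
  norm_num at this

/-- If `4 ^ |A| < 40` it is enough that some unitary is not a product operator; otherwise at least
one straddling gate is allowed for, and the parameter count dominates its lower order terms. -/
theorem exists_unitary_straddlingCount_ge (h1 : 1 ≤ A.card) (h2 : A.card ≤ Aᶜ.card) :
    ∃ U ∈ unitaryGroup (Q → Fin 2) ℂ, ∀ c : BipartiteCircuit A, c.toMatrix = U →
      4 ^ A.card ≤ 40 * c.straddlingCount := by
  by_contra! hcon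
  have hA : A.Nonempty := Finset.card_pos.1 h1
  have hA' : Aᶜ.Nonempty := Finset.card_pos.1 (h1.trans h2)
  have hall : ∀ U ∈ unitaryGroup (Q → Fin 2) ℂ, ∃ c : BipartiteCircuit A, c.toMatrix = U ∧
      c.straddlingCount ≤ 4 ^ A.card / 40 := by
    intro U hU
    obtain ⟨c, hc, hlt⟩ := hcon U hU
    exact ⟨c, hc, by omega⟩
  rcases Nat.eq_zero_or_pos (4 ^ A.card / 40) with h0 | hpos
  · obtain ⟨U, hU, hU'⟩ := exists_unitary_notMem_productOperators hA hA'
    obtain ⟨c, rfl, hc⟩ := hall U hU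
    rw [h0, Nat.le_zero] at hc
    have := c.toMatrix_mem_alternatingProducts
    rw [hc] at this
    exact hU' this
  · have hb := card_bound_of_circuits hall
    have hm : 40 * (4 ^ A.card / 40) ≤ 4 ^ A.card := Nat.mul_div_le _ _
    set m := 4 ^ A.card / 40
    have hle : 4 ^ A.card ≤ 4 ^ Aᶜ.card := Nat.pow_le_pow_right (by norm_num) h2
    have h4 : 4 ≤ 4 ^ Aᶜ.card := Nat.le_self_pow (by omega) 4
    rw [← Finset.card_add_card_compl A, pow_add] at hb
    set a := 4 ^ A.card
    set b := 4 ^ Aᶜ.card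
    have e1 : (m + 1) * (a + b) ≤ 4 * (m * b) := by nlinarith
    have e2 : 16 * m ≤ 4 * (m * b) := by nlinarith
    have e3 : 1 ≤ m * b := by nlinarith
    have e4 : a * b ≤ 36 * (m * b) := by omega
    have e5 : 40 * (m * b) ≤ a * b := by nlinarith
    omega

end

theorem theorem2 :
    (∃ C : ℝ, 0 < C ∧
      ∀ (n k₁ k₂ : ℕ) (A : Finset (Fin n)), A.card = k₁ → Aᶜ.card = k₂ → k₁ ≤ k₂ →
        ∀ U : Matrix.unitaryGroup (Fin n → Fin 2) ℂ,
          ∃ c : BipartiteCircuit A,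
            BipartiteCircuit.toMatrix c = (U : Matrix (Fin n → Fin 2) (Fin n → Fin 2) ℂ) ∧
            (BipartiteCircuit.straddlingCount c : ℝ) ≤ C * 4 ^ k₁) ∧
    (∃ C' : ℝ, 0 < C' ∧
      ∀ (n k₁ k₂ : ℕ) (A : Finset (Fin n)), A.card = k₁ → Aᶜ.card = k₂ → 1 ≤ k₁ → k₁ ≤ k₂ →
        ∃ U : Matrix.unitaryGroup (Fin n → Fin 2) ℂ,
          ∀ c : BipartiteCircuit A,
            BipartiteCircuit.toMatrix c = (U : Matrix (Fin n → Fin 2) (Fin n → Fin 2) ℂ) →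
            C' * 4 ^ k₁ ≤ (BipartiteCircuit.straddlingCount c : ℝ)) := by
  refine ⟨⟨6, by norm_num, ?_⟩, ⟨1 / 40, by norm_num, ?_⟩⟩
  · rintro n _ _ A rfl rfl h U
    obtain ⟨c, hc, hm⟩ := implementable_of_card_le h U.2
    exact ⟨c, hc, by exact_mod_cast hm⟩
  · rintro n _ _ A rfl rfl h1 h2
    obtain ⟨U, hU, h⟩ := exists_unitary_straddlingCount_ge h1 h2
    refine ⟨⟨U, hU⟩, fun c hc => ?_⟩
    have : (4 : ℝ) ^ A.card ≤ 40 * (BipartiteCircuit.straddlingCount c : ℝ) := by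
      exact_mod_cast h c hc
    linarith
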